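/- Let $B_1\subset\mathbb R^2$ be the open unit disk and let $u$ be the velocity field given in polar coordinates by $u(r,\theta)=2\pi r^2(\sin\theta,-\cos\theta)$. Let $\rho_0\in L^\infty(\mathbb R^2)$ vanish outside $\overline{B_1}$ and satisfy $\int_{\partial B_r}\rho_0\,dS_r=0$ for almost every $r>0$. Let $\rho$ be the bounded, weakly continuous in time, distributional solution of $$\partial_t\rho+\operatorname{div}(u\rho)=0\ \text{ on }[0,\infty)\times B_1,\qquad \rho(0,\cdot)=\rho_0 .$$ Fix an accuracy parameter $0<\kappa<1$ and let the geometric mixing scale $\mathcal G(\rho(t))$ be the infimum of all $\varepsilon>0$ such that $$\Big|\frac1{|B_\varepsilon(x)|}\int_{B_\varepsilon(x)}\rho(t,y)\,dy\Big|\le\kappa\,\|\rho(t,\cdot)\|_{L^\infty(B_1)}\qquad\text{for every }x\in\mathbb R^2,$$ where $\rho(t,\cdot)$ is extended by zero outside $B_1$. (i) There is an absolute constant $C>0$ such that, if $\rho_0$ is continuous on $\overline{B_1}$, then there is a constant $\widetilde C>0$ depending only on $\rho_0$ and $\kappa$ with $$\mathcal G(\rho(t))\le \frac{C}{\kappa^2}\,t^{-1}\qquad\text{for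 all }t\ge\widetilde C .$$ The rate $t^{-1}$ is optimal: if $\rho_0$ is continuous on $\overline{B_1}$ and not identically zero, then there is $c>0$, depending only on $\rho_0$ and $\kappa$, with $\mathcal G(\rho(t))\ge c\,t^{-1}$ for all $t\ge1$. (ii) If $\alpha\in(0,1]$ and $\rho_0\in\dot W^{\alpha,1}(B_1)$, that is, $\|\rho_0\|_{\dot W^{\alpha,1}}<\infty$, where $$\|\rho_0\|_{\dot W^{\alpha,1}}=\iint_{B_1\times B_1}\frac{|\rho_0(x)-\rho_0(y)|}{|x-y|^{2+\alpha}}\,dx\,dy\ \ (\alpha<1),\qquad \|\rho_0\|_{\dot W^{1,1}}=\int_{B_1}|\nabla\rho_0|\,dx$$ (with $\nabla\rho_0$ the weak gradient), then $$\mathcal G(\rho(t))\le C_1\,t^{-\alpha/2}\qquad\text{for all }t\ge C_2,$$ with constants $C_1,C_2>0$ depending only on $\alpha$, $\kappa$, $\|\rho_0\|_{\dot W^{\alpha,1}}$ and $\|\rho_0\|_{L^\infty}$. -/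

import Mathlib

open Real Set MeasureTheory
open scoped ENNReal ContDiff

noncomputable section

/-- The Euclidean plane. -/
abbrev Plane : Type := EuclideanSpace ℝ (Fin 2)

/-- The open unit disk `B₁`. -/
def unitDisk : Set Plane := Metric.ball 0 1

/-- The point with polar coordinates `(r, θ)`. -/
def polarPoint (r θ : ℝ) : Plane := !₂[r * cos θ, r * sin θ]

/-- The stationary velocity field `u(r, θ) = 2π r² (sin θ, -cos θ)`, in Cartesian coordinates. -/
def velocity (x : Plane) : Plane := (2 * π * ‖x‖) • !₂[x 1, -x 0]

theorem velocity_polarPoint {r : ℝ} (hr : 0 ≤ r) (θ : ℝ) :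
    velocity (polarPoint r θ) = (2 * π * r ^ 2) • !₂[sin θ, -cos θ] := by
  have h : ‖polarPoint r θ‖ = r := by
    rw [EuclideanSpace.norm_eq, show ∑ i, ‖polarPoint r θ i‖ ^ 2 = r ^ 2 by
      simp [polarPoint, Fin.sum_univ_two, mul_pow, ← mul_add]]
    exact Real.sqrt_sq hr
  rw [velocity, h]
  ext i
  fin_cases i <;> simp [polarPoint] <;> ring

/-- The norm of `L^∞(B₁)` (essential supremum of `|f|`). -/
def linftyNorm (f : Plane → ℝ) : ℝ := (eLpNorm f ⊤ (volume.restrict unitDisk)).toReal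

/-- Initial data: bounded functions that vanish outside the closed unit disk and have zero
average on almost every circle centred at the origin. The arc length on `∂B_r` is `r dθ`. -/
structure IsInitialDatum (ρ₀ : Plane → ℝ) : Prop where
  bounded : MemLp ρ₀ ⊤ volume
  zero_outside : ∀ x, x ∉ Metric.closedBall (0 : Plane) 1 → ρ₀ x = 0
  circle_average : ∀ᵐ r ∂(volume.restrict (Ioi (0 : ℝ))),
    ∫ θ in (0 : ℝ)..(2 * π), ρ₀ (polarPoint r θ) * r = 0

/-- `ρ` is the (time-continuous representative of a) bounded distributional solution on
`[0,∞) × B₁` of the Cauchy problem `∂ₜρ + div (v ρ) = 0`, `ρ(0,·) = ρ₀`: it is bounded and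
measurable, `t ↦ ρ(t,·)` is weakly continuous on `[0,∞)`, and
`∫∫ ρ (∂ₜφ + v·∇φ) dx dt + ∫ ρ₀ φ(0,·) dx = 0` for every test function
`φ ∈ C_c^∞([0,∞) × B₁)`. -/
structure IsSolution (v : Plane → Plane) (ρ₀ : Plane → ℝ) (ρ : ℝ → Plane → ℝ) : Prop where
  measurable : AEStronglyMeasurable (fun p : ℝ × Plane => ρ p.1 p.2)
    ((volume.restrict (Ici (0 : ℝ))).prod (volume.restrict unitDisk))
  measurable_slice : ∀ t, 0 ≤ t → AEStronglyMeasurable (ρ t) (volume.restrict unitDisk)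
  bounded : ∃ M : ℝ, ∀ t, 0 ≤ t → ∀ᵐ x ∂(volume.restrict unitDisk), |ρ t x| ≤ M
  weakly_continuous : ∀ ψ : Plane → ℝ, ContDiff ℝ ∞ ψ → HasCompactSupport ψ →
    tsupport ψ ⊆ unitDisk → ContinuousOn (fun t => ∫ x in unitDisk, ρ t x * ψ x) (Ici 0)
  weak_equation : ∀ φ : ℝ × Plane → ℝ, ContDiff ℝ ∞ φ → HasCompactSupport φ →
    tsupport φ ⊆ univ ×ˢ unitDisk →
    (∫ t in Ioi (0 : ℝ), ∫ x in unitDisk, ρ t x * fderiv ℝ φ (t, x) (1, v x))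
      + ∫ x in unitDisk, ρ₀ x * φ (0, x) = 0

/-- The geometric mixing scale with accuracy `κ` of a function `f` on `B₁` (extended by zero to
the plane): the infimum of all `ε > 0` such that the average of `f` over every disk of radius `ε`
is at most `κ ‖f‖_{L^∞(B₁)}` in absolute value. For `κ > 0` and bounded `f` every `ε ≥ κ^{-1/2}`
is admissible, so that this is the infimum of a nonempty set of positive numbers. -/
def geometricMixingScale (κ : ℝ) (f : Plane → ℝ) : ℝ :=
  sInf {ε : ℝ | 0 < ε ∧ ∀ x : Plane,
    |⨍ y in Metric.ball x ε, unitDisk.indicator f y| ≤ κ * linftyNorm f}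

/-- `g` is the weak gradient of `f` on `B₁`. -/
structure IsWeakGradient (f : Plane → ℝ) (g : Plane → Plane) : Prop where
  locallyIntegrable_fun : LocallyIntegrableOn f unitDisk
  locallyIntegrable_grad : LocallyIntegrableOn g unitDisk
  integral_eq : ∀ φ : Plane → ℝ, ContDiff ℝ ∞ φ → HasCompactSupport φ →
    tsupport φ ⊆ unitDisk → ∀ w : Plane,
    ∫ x in unitDisk, f x * fderiv ℝ φ x w = -∫ x in unitDisk, inner ℝ (g x) w * φ x

/-- The homogeneous seminorm of `Ẇ^{α,1}(B₁)` for `0 < α ≤ 1`: the Gagliardo seminorm if `α < 1`,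
the `L¹` norm of the weak gradient if `α = 1`. Weak gradients are unique almost everywhere, so
the infimum is over at most one value; it is `∞` if there is no weak gradient. The function `f`
belongs to `Ẇ^{α,1}(B₁)` when the value is finite. -/
def sobolevSeminorm (α : ℝ) (f : Plane → ℝ) : ℝ≥0∞ :=
  if α = 1 then ⨅ (g : Plane → Plane) (_ : IsWeakGradient f g), ∫⁻ x in unitDisk, ‖g x‖ₑ
  else ∫⁻ x in unitDisk, ∫⁻ y in unitDisk, ENNReal.ofReal (|f x - f y| / ‖x - y‖ ^ (2 + α))

end

/-! A particle at distance `r` from the origin turns clockwise with angular speed `2πr`, so the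
solution is `ρ₀ ∘ flow (-t)`, and circles whose radii differ by `s / t` are sheared against each
other by exactly `s` full turns in time `t`. Hence moving a point outward by `s / t` before `flow
(-t)` amounts to rotating by `2πs` and moving outward afterwards (`flow_neg_radialShift`).

Take the integral of the solution over a disk of radius `ε`. Precomposing with the radial shift
costs only a boundary error of order `‖ρ₀‖ (ε / t + 1 / t²)`, because the shift displaces points by
at most `1 / t` and expands areas. Removing the shift from the argument of `ρ₀` costs the
oscillation of `ρ₀` at scale `1 / t`. What remains is `ρ₀` rotated by `2πs`; its average over `s ∈
[0, 1]` is a mean over a full circle, which is zero. This is `abs_integral_ball_flow_le`, the core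
of both upper bounds.

For continuous data the oscillation is at most `κ‖ρ₀‖ / 2` per unit area, except in a layer of width
`1 / t` along the unit circle, where the extension by zero may jump; a disk of radius `ε` meets that
layer in area `O(ε / t)` (`volume_ball_inter_annulus_le`). After division by `ε²` the errors are
admissible for `ε` of order `κ⁻² / t`. Conversely `flow (-t)` is Lipschitz on the disk with constant
`1 + 2πt` (`norm_flow_sub_flow_le`), so some disk of radius of order `1 / t` is carried into a
neighbourhood where `|ρ₀|` exceeds `κ‖ρ₀‖`.

For Sobolev data the oscillation is small only in `L¹`: it is `O(t^(-α))` over the whole plane, with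
no gain from the size of the disk, and division by `ε²` yields `ε` of order `t^(-α/2)`. Both
seminorms enter only through a bound `K r^(2+α)` for the integral of `|f x - f z|` over pairs at
distance less than `r`; `lintegral_radialShift_sub_le` passes from such pairs to radial shifts.

The formula for the solution (`IsSolution.ae_eq_comp_flow`) follows by duality: its pairing with a
test function carried along by the flow is constant in time. -/

noncomputable section

/-! ### Polar coordinates and area-preserving twists -/

/-- Integration in polar coordinates over the Euclidean plane. -/
theorem lintegral_polar {F : Plane → ℝ≥0∞} (hF : Measurable F) :
    ∫⁻ x, F x = ∫⁻ r in Ioi (0 : ℝ), ∫⁻ θ in Ioc (-π) π,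
      ENNReal.ofReal r * F (polarPoint r θ) := by
  have h1 := (PiLp.volume_preserving_toLp (Fin 2)).lintegral_comp_emb
    (MeasurableEquiv.toLp 2 (Fin 2 → ℝ)).measurableEmbedding F
  have h2 := ((volume_preserving_finTwoArrow ℝ).symm).lintegral_comp_emb
    (MeasurableEquiv.finTwoArrow (α := ℝ)).symm.measurableEmbedding
    (fun v => F (WithLp.toLp 2 v))
  rw [← h1, ← h2, ← lintegral_comp_polarCoord_symm]
  have hm : Measurable fun p : ℝ × ℝ => polarPoint p.1 p.2 := by
    have : Continuous fun p : ℝ × ℝ => polarPoint p.1 p.2 := by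
      unfold polarPoint; fun_prop
    exact this.measurable
  have h3 : ∀ p : ℝ × ℝ, ENNReal.ofReal p.1 • F (WithLp.toLp 2
      ((MeasurableEquiv.finTwoArrow (α := ℝ)).symm (polarCoord.symm p))) =
      ENNReal.ofReal p.1 * F (polarPoint p.1 p.2) := fun p => rfl
  simp_rw [h3]
  rw [polarCoord_target, Measure.volume_eq_prod, setLIntegral_prod]
  · refine lintegral_congr fun r => ?_
    exact setLIntegral_congr Ioo_ae_eq_Ioc
  · exact (Measurable.mul (by fun_prop) (hF.comp hm)).aemeasurable

theorem norm_polarPoint {r : ℝ} (hr : 0 ≤ r) (θ : ℝ) : ‖polarPoint r θ‖ = r := by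
  rw [EuclideanSpace.norm_eq, show ∑ i, ‖polarPoint r θ i‖ ^ 2 = r ^ 2 by
    simp [polarPoint, Fin.sum_univ_two, mul_pow, ← mul_add]]
  exact Real.sqrt_sq hr

theorem polarPoint_periodic (r : ℝ) : Function.Periodic (polarPoint r) (2 * π) := by
  intro θ; simp [polarPoint]

theorem exists_polarPoint_eq (x : Plane) : ∃ θ, x = polarPoint ‖x‖ θ := by
  refine ⟨Complex.arg ⟨x 0, x 1⟩, ?_⟩
  have hn : ‖x‖ = ‖(⟨x 0, x 1⟩ : ℂ)‖ := by
    rw [EuclideanSpace.norm_eq, Complex.norm_def, Complex.normSq_apply]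
    simp [Fin.sum_univ_two, sq]
  rw [hn]
  ext i
  fin_cases i
  · simp [polarPoint]
  · simp [polarPoint]

/-- Counterclockwise rotation of the plane by the angle `a`. -/
def rotate (a : ℝ) (x : Plane) : Plane :=
  !₂[cos a * x 0 - sin a * x 1, sin a * x 0 + cos a * x 1]

theorem rotate_polarPoint (a r θ : ℝ) : rotate a (polarPoint r θ) = polarPoint r (θ + a) := by
  ext i
  fin_cases i
  · simp [rotate, polarPoint, cos_add]; ring
  · simp [rotate, polarPoint, sin_add]; ring

theorem norm_rotate (a : ℝ) (x : Plane) : ‖rotate a x‖ = ‖x‖ := by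
  obtain ⟨θ, hθ⟩ := exists_polarPoint_eq x
  rw [hθ, rotate_polarPoint, norm_polarPoint (norm_nonneg _), norm_polarPoint (norm_nonneg _)]

theorem rotate_rotate (a b : ℝ) (x : Plane) : rotate a (rotate b x) = rotate (b + a) x := by
  obtain ⟨θ, hθ⟩ := exists_polarPoint_eq x
  rw [hθ, rotate_polarPoint, rotate_polarPoint, rotate_polarPoint, add_assoc]

theorem rotate_zero (x : Plane) : rotate 0 x = x := by
  ext i; fin_cases i <;> simp [rotate]

theorem continuous_rotate : Continuous fun p : ℝ × Plane => rotate p.1 p.2 := by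
  unfold rotate; fun_prop

/-- Rotation by an angle depending on the distance to the origin. -/
def twist (g : ℝ → ℝ) (x : Plane) : Plane := rotate (g ‖x‖) x

theorem norm_twist (g : ℝ → ℝ) (x : Plane) : ‖twist g x‖ = ‖x‖ := norm_rotate _ _

theorem twist_polarPoint (g : ℝ → ℝ) {r : ℝ} (hr : 0 ≤ r) (θ : ℝ) :
    twist g (polarPoint r θ) = polarPoint r (θ + g r) := by
  rw [twist, norm_polarPoint hr, rotate_polarPoint]

theorem twist_twist (g k : ℝ → ℝ) (x : Plane) :
    twist g (twist k x) = twist (fun r => k r + g r) x := by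
  rw [twist, norm_twist, twist, rotate_rotate, twist]

theorem measurable_twist {g : ℝ → ℝ} (hg : Measurable g) : Measurable (twist g) := by
  have h1 : Measurable fun x : Plane => (g ‖x‖, x) :=
    (hg.comp measurable_norm).prodMk measurable_id
  have h2 : twist g = (fun p : ℝ × Plane => rotate p.1 p.2) ∘ fun x => (g ‖x‖, x) := rfl
  rw [h2]
  exact continuous_rotate.measurable.comp h1

/-- Any two half-open intervals of length `2π` are fundamental domains for the translations by
`2πℤ`. -/
theorem setLIntegral_add_of_periodic {f : ℝ → ℝ≥0∞} (hf : Function.Periodic f (2 * π)) (a : ℝ) :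
    ∫⁻ θ in Ioc (-π) π, f (θ + a) = ∫⁻ θ in Ioc (-π) π, f θ := by
  have h1 : ∫⁻ θ in Ioc (-π) π, f (θ + a) = ∫⁻ θ in Ioc (-π + a) (-π + a + 2 * π), f θ := by
    rw [← (measurePreserving_add_right volume a).setLIntegral_comp_preimage_emb
      (measurableEmbedding_addRight a) f (Ioc (-π + a) (-π + a + 2 * π))]
    simp only [preimage_add_const_Ioc]
    congr 3 <;> ring
  have hT : 0 < 2 * π := by positivity
  rw [h1]
  have h2 := (isAddFundamentalDomain_Ioc hT (-π + a) volume).setLIntegral_eq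
    (isAddFundamentalDomain_Ioc hT (-π) volume) f hf.map_vadd_zmultiples
  rw [h2]
  congr 3; ring

/-- In polar coordinates a twist is, on each circle, a translation of the angle, which preserves arc
length. Measurability of `g` is therefore enough, without any Jacobian. -/
theorem measurePreserving_twist {g : ℝ → ℝ} (hg : Measurable g) :
    MeasurePreserving (twist g) := by
  refine ⟨measurable_twist hg, ?_⟩
  refine Measure.ext fun A hA => ?_
  rw [Measure.map_apply (measurable_twist hg) hA, ← lintegral_indicator_one hA,
    ← lintegral_indicator_one (measurable_twist hg hA),
    lintegral_polar (measurable_one.indicator hA),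
    lintegral_polar (measurable_one.indicator (measurable_twist hg hA))]
  refine setLIntegral_congr_fun measurableSet_Ioi fun r hr => ?_
  have hr' : 0 ≤ r := le_of_lt hr
  have := setLIntegral_add_of_periodic
    (f := fun θ => ENNReal.ofReal r * A.indicator 1 (polarPoint r θ))
    (fun θ => by simp only [polarPoint_periodic r θ]) (g r)
  refine Eq.trans ?_ this
  refine lintegral_congr fun θ => ?_
  rw [← twist_polarPoint g hr']
  rfl

theorem measurePreserving_rotate (a : ℝ) : MeasurePreserving (rotate a) :=
  measurePreserving_twist (g := fun _ => a) measurable_const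

/-! ### Radial shifts and circular means -/

/-- The map that moves every point away from the origin by the distance `d`. -/
def radialShift (d : ℝ) (x : Plane) : Plane := (1 + d / ‖x‖) • x

theorem radialShift_polarPoint (d : ℝ) {r : ℝ} (hr : 0 < r) (θ : ℝ) :
    radialShift d (polarPoint r θ) = polarPoint (r + d) θ := by
  rw [radialShift, norm_polarPoint hr.le]
  have : 1 + d / r = (r + d) / r := by field_simp
  rw [this]
  ext i
  fin_cases i <;> (simp [polarPoint]; field_simp)

theorem measurable_radialShift (d : ℝ) : Measurable (radialShift d) := by
  unfold radialShift
  exact ((measurable_const.add (measurable_const.div measurable_norm)).smul measurable_id)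

theorem norm_radialShift_sub (d : ℝ) (x : Plane) : ‖radialShift d x - x‖ ≤ |d| := by
  have : radialShift d x - x = (d / ‖x‖) • x := by rw [radialShift]; module
  rw [this, norm_smul, norm_div, norm_norm]
  rcases eq_or_ne ‖x‖ 0 with h | h
  · simp [h]
  · rw [div_mul_cancel₀ _ h]; rfl

theorem norm_radialShift {d : ℝ} {x : Plane} (hx : x ≠ 0) (hd : 0 ≤ ‖x‖ + d) :
    ‖radialShift d x‖ = ‖x‖ + d := by
  have hx' : 0 < ‖x‖ := norm_pos_iff.2 hx
  rw [radialShift, norm_smul, show 1 + d / ‖x‖ = (‖x‖ + d) / ‖x‖ by field_simp,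
    Real.norm_of_nonneg (by positivity)]
  field_simp

/-- The change of variables formula for the radial shift. -/
theorem lintegral_radialShift {d : ℝ} (hd : 0 ≤ d) {F : Plane → ℝ≥0∞} (hF : Measurable F) :
    ∫⁻ x, ENNReal.ofReal ((‖x‖ + d) / ‖x‖) * F (radialShift d x) =
      ∫⁻ y in {y : Plane | d < ‖y‖}, F y := by
  have hset : MeasurableSet {y : Plane | d < ‖y‖} := measurableSet_lt measurable_const measurable_norm
  rw [← lintegral_indicator hset, lintegral_polar (hF.indicator hset), lintegral_polar (by
    exact (ENNReal.measurable_ofReal.comp (by fun_prop)).mul (hF.comp (measurable_radialShift d)))]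
  set K : ℝ → ℝ≥0∞ := fun r => ∫⁻ θ in Ioc (-π) π, ENNReal.ofReal r * F (polarPoint r θ) with hK
  have h1 : ∫⁻ r in Ioi (0 : ℝ), (∫⁻ θ in Ioc (-π) π, ENNReal.ofReal r *
      (ENNReal.ofReal ((‖polarPoint r θ‖ + d) / ‖polarPoint r θ‖) *
        F (radialShift d (polarPoint r θ)))) = ∫⁻ r in Ioi (0 : ℝ), K (r + d) := by
    refine setLIntegral_congr_fun measurableSet_Ioi fun r (hr : 0 < r) => ?_
    refine lintegral_congr fun θ => ?_
    rw [norm_polarPoint hr.le, radialShift_polarPoint d hr, ← mul_assoc,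
      ← ENNReal.ofReal_mul hr.le]
    -- The density `(r + d) / r` turns the polar weight `r` into the weight `r + d` of the image
    -- circle.
    congr 2; field_simp
  have h2 : ∫⁻ r in Ioi (0 : ℝ), (∫⁻ θ in Ioc (-π) π, ENNReal.ofReal r *
      ({y : Plane | d < ‖y‖}.indicator F (polarPoint r θ))) =
      ∫⁻ r in Ioi (0 : ℝ), (Ioi d).indicator K r := by
    refine setLIntegral_congr_fun measurableSet_Ioi fun r (hr : 0 < r) => ?_
    simp only [indicator, mem_Ioi, mem_ofPred_eq, norm_polarPoint hr.le]
    split_ifs <;> simp [hK]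
  rw [h1, h2, lintegral_indicator measurableSet_Ioi, Measure.restrict_restrict measurableSet_Ioi,
    inter_eq_left.2 (Ioi_subset_Ioi hd)]
  rw [← (measurePreserving_add_right volume d).setLIntegral_comp_preimage_emb
      (measurableEmbedding_addRight d) K (Ioi d)]
  simp

/-- The radial shift does not decrease areas. -/
theorem lintegral_radialShift_le {d : ℝ} (hd : 0 ≤ d) {F : Plane → ℝ≥0∞} (hF : Measurable F) :
    ∫⁻ x, F (radialShift d x) ≤ ∫⁻ y, F y := by
  calc ∫⁻ x, F (radialShift d x)
      ≤ ∫⁻ x, ENNReal.ofReal ((‖x‖ + d) / ‖x‖) * F (radialShift d x) := by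
        have h0 : ∀ᵐ x : Plane, x ≠ 0 := by
          simp [ae_iff]
        refine lintegral_mono_ae (h0.mono fun x hx => ?_)
        have hx' : 0 < ‖x‖ := norm_pos_iff.2 hx
        refine le_mul_of_one_le_left' ?_
        rw [ENNReal.one_le_ofReal, le_div_iff₀ hx']
        linarith
    _ = ∫⁻ y in {y : Plane | d < ‖y‖}, F y := lintegral_radialShift hd hF
    _ ≤ ∫⁻ y, F y := setLIntegral_le_lintegral _ _

/-- By polar coordinates, a null set of radii sweeps out a null set of the plane. This transfers the
hypothesis on almost every circle to almost every point. -/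
theorem ae_norm_of_ae {P : ℝ → Prop} (h : ∀ᵐ r ∂(volume.restrict (Ioi (0 : ℝ))), P r) :
    ∀ᵐ x : Plane, P ‖x‖ := by
  obtain ⟨N, hN, hNm, hN0⟩ := exists_measurable_superset_of_null (ae_iff.1 h)
  have : volume ((fun x : Plane => ‖x‖) ⁻¹' N) = 0 := by
    rw [← lintegral_indicator_one (measurable_norm hNm),
      lintegral_polar (measurable_one.indicator (measurable_norm hNm))]
    have : ∀ᵐ r ∂(volume.restrict (Ioi (0 : ℝ))), r ∉ N := by
      rw [ae_iff]; simpa using hN0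
    refine (lintegral_congr_ae (g := fun _ => 0) ?_).trans (by simp)
    filter_upwards [this, self_mem_ae_restrict measurableSet_Ioi] with r hr (hr0 : 0 < r)
    simp [indicator, norm_polarPoint hr0.le, hr]
  rw [ae_iff]
  refine measure_mono_null (fun x hx => hN hx) this

/-- If the means of `f` over almost all circles centred at the origin vanish, then so do the
means of `f` over the rotations of almost every point. -/
theorem ae_integral_rotate_eq_zero {f : Plane → ℝ}
    (h : ∀ᵐ r ∂(volume.restrict (Ioi (0 : ℝ))),
      ∫ θ in (0 : ℝ)..(2 * π), f (polarPoint r θ) * r = 0) :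
    ∀ᵐ x : Plane, ∫ s in (0 : ℝ)..1, f (rotate (2 * π * s) x) = 0 := by
  have h0 : ∀ᵐ x : Plane, x ≠ 0 := by simp [ae_iff]
  filter_upwards [ae_norm_of_ae h, h0] with x hx hx0
  have hx' : 0 < ‖x‖ := norm_pos_iff.2 hx0
  rw [intervalIntegral.integral_mul_const, mul_eq_zero, or_iff_left hx'.ne'] at hx
  obtain ⟨φ, hφ⟩ := exists_polarPoint_eq x
  set r := ‖x‖
  rw [hφ]
  simp_rw [rotate_polarPoint]
  rw [intervalIntegral.integral_comp_add_mul (fun θ => f (polarPoint r θ)) (by positivity) φ]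
  have hp : Function.Periodic (fun θ => f (polarPoint r θ)) (2 * π) := fun θ => by
    simp only [polarPoint_periodic r θ]
  have := hp.intervalIntegral_add_eq φ 0
  simp only [mul_zero, add_zero, mul_one, zero_add] at this ⊢
  rw [this, hx, smul_zero]

/-! ### The flow and the basic mixing estimate -/

/-- The flow of `velocity`. -/
def flow (t : ℝ) : Plane → Plane := twist fun r => -(2 * π * t * r)

theorem norm_flow (t : ℝ) (x : Plane) : ‖flow t x‖ = ‖x‖ := norm_twist _ _

theorem flow_flow (s t : ℝ) (x : Plane) : flow s (flow t x) = flow (s + t) x := by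
  simp only [flow, twist_twist]
  congr 1; funext r; ring

theorem flow_zero (x : Plane) : flow 0 x = x := by
  simp [flow, twist, rotate_zero]

theorem measurePreserving_flow (t : ℝ) : MeasurePreserving (flow t) :=
  measurePreserving_twist (by fun_prop)

/-- In the time in which the flow at distance `r + s / t` makes `s` more turns than that at
distance `r`, shifting radially and flowing commute up to a rotation. -/
theorem flow_neg_radialShift {s t : ℝ} (hs : 0 ≤ s) (ht : 0 < t) {x : Plane} (hx : x ≠ 0) :
    flow (-t) (radialShift (s / t) x) =
      radialShift (s / t) (rotate (2 * π * s) (flow (-t) x)) := by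
  have hx' : 0 < ‖x‖ := norm_pos_iff.2 hx
  have hst : 0 ≤ s / t := by positivity
  obtain ⟨θ, hθ⟩ := exists_polarPoint_eq x
  rw [hθ, radialShift_polarPoint _ hx', flow, twist_polarPoint _ (by positivity),
    twist_polarPoint _ hx'.le, rotate_polarPoint, radialShift_polarPoint _ hx']
  -- The angles agree because `2πt(r + s/t) = 2πtr + 2πs`.
  congr 1
  field_simp
  ring

theorem volume_real_ball_plane (x : Plane) {r : ℝ} (hr : 0 ≤ r) :
    volume.real (Metric.ball x r) = π * r ^ 2 := by
  rw [Measure.real, EuclideanSpace.volume_ball_fin_two, ENNReal.toReal_mul, ENNReal.toReal_pow,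
    ENNReal.toReal_ofReal hr, ENNReal.toReal_ofReal pi_nonneg, mul_comm]

/-- Integration of the nonnegative functions `B - f` and `B + f` is monotone in the measure. The
lemma compares the Lebesgue measure on a disk with its image under a radial shift, through a measure
that dominates both. -/
theorem abs_integral_sub_integral_le_of_le {α : Type*} [MeasurableSpace α] {μ V : Measure α}
    [IsFiniteMeasure V] (hμ : μ ≤ V) {f : α → ℝ} (hf : Measurable f) {B : ℝ}
    (hB : ∀ x, |f x| ≤ B) :
    |(∫ x, f x ∂V) - ∫ x, f x ∂μ| ≤ B * (V.real univ - μ.real univ) := by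
  have : IsFiniteMeasure μ := isFiniteMeasure_of_le V hμ
  have hi : ∀ (m : Measure α) [IsFiniteMeasure m], Integrable f m := fun m _ =>
    Integrable.of_bound hf.aestronglyMeasurable B (Filter.Eventually.of_forall hB)
  have h1 : ∫ x, (B - f x) ∂μ ≤ ∫ x, (B - f x) ∂V :=
    integral_mono_measure hμ (Filter.Eventually.of_forall fun x => by
      simp only [Pi.zero_apply]; linarith [(abs_le.1 (hB x)).2]) ((integrable_const B).sub (hi V))
  have h2 : ∫ x, (B + f x) ∂μ ≤ ∫ x, (B + f x) ∂V :=
    integral_mono_measure hμ (Filter.Eventually.of_forall fun x => by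
      simp only [Pi.zero_apply]; linarith [(abs_le.1 (hB x)).1]) ((integrable_const B).add (hi V))
  rw [integral_sub (integrable_const _) (hi _), integral_sub (integrable_const _) (hi _)] at h1
  rw [integral_add (integrable_const _) (hi _), integral_add (integrable_const _) (hi _)] at h2
  simp only [integral_const, smul_eq_mul] at h1 h2
  rw [abs_le]
  constructor <;> linarith

/-- The shift does not decrease areas, so its image measure has density at most one, and it moves
points by at most `d`, so the image lies in the enlarged disk. -/
theorem map_radialShift_restrict_ball_le {d : ℝ} (hd : 0 ≤ d) (x₀ : Plane) (ε : ℝ) :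
    (volume.restrict (Metric.ball x₀ ε)).map (radialShift d) ≤
      volume.restrict (Metric.ball x₀ (ε + d)) := by
  refine Measure.le_iff.2 fun A hA => ?_
  have hAm : MeasurableSet (A ∩ Metric.ball x₀ (ε + d)) := hA.inter measurableSet_ball
  rw [Measure.map_apply (measurable_radialShift d) hA,
    Measure.restrict_apply (measurable_radialShift d hA), Measure.restrict_apply hA,
    ← lintegral_indicator_one hAm]
  refine le_trans ?_ (lintegral_radialShift_le hd (measurable_one.indicator hAm))
  have : ∫⁻ x, (A ∩ Metric.ball x₀ (ε + d)).indicator 1 (radialShift d x) =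
      volume (radialShift d ⁻¹' (A ∩ Metric.ball x₀ (ε + d))) :=
    lintegral_indicator_one (measurable_radialShift d hAm)
  rw [this]
  refine measure_mono fun x hx => ⟨hx.1, ?_⟩
  have h1 := norm_radialShift_sub d x
  have h2 := hx.2
  rw [Metric.mem_ball, dist_eq_norm] at *
  calc ‖radialShift d x - x₀‖ = ‖(radialShift d x - x) + (x - x₀)‖ := by congr 1; abel
    _ ≤ ‖radialShift d x - x‖ + ‖x - x₀‖ := norm_add_le _ _
    _ < ε + d := by rw [abs_of_nonneg hd] at h1; linarith

/-- A radial shift by `d` changes the integral of a bounded function over a disk of radius `ε`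
only by `O(ε d + d ^ 2)`. -/
theorem abs_integral_ball_sub_integral_radialShift_le {f : Plane → ℝ} (hf : Measurable f) {B : ℝ}
    (hB : ∀ x, |f x| ≤ B) {d ε : ℝ} (hd : 0 ≤ d) (hε : 0 ≤ ε) (x₀ : Plane) :
    |(∫ x in Metric.ball x₀ ε, f x) - ∫ x in Metric.ball x₀ ε, f (radialShift d x)| ≤
      2 * π * B * (2 * ε * d + d ^ 2) := by
  have hV : IsFiniteMeasure (volume.restrict (Metric.ball x₀ (ε + d))) :=
    isFiniteMeasure_restrict.2 measure_ball_lt_top.ne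
  have h1 := abs_integral_sub_integral_le_of_le
    (Measure.restrict_mono_set volume (Metric.ball_subset_ball (x := x₀)
      (le_add_of_nonneg_right hd : ε ≤ ε + d))) hf hB
  have h2 := abs_integral_sub_integral_le_of_le (map_radialShift_restrict_ball_le hd x₀ ε) hf hB
  rw [integral_map (measurable_radialShift d).aemeasurable hf.aestronglyMeasurable] at h2
  have h3 : ((volume.restrict (Metric.ball x₀ ε)).map (radialShift d)).real univ = π * ε ^ 2 := by
    rw [map_measureReal_apply (measurable_radialShift d) MeasurableSet.univ]
    simp [volume_real_ball_plane x₀ hε]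
  rw [h3] at h2
  simp only [measureReal_restrict_apply_univ, volume_real_ball_plane x₀ hε,
    volume_real_ball_plane x₀ (add_nonneg hε hd)] at h1 h2
  rw [abs_le] at *
  constructor <;> nlinarith [h1.1, h1.2, h2.1, h2.2]

/-- The basic mixing estimate: the integral over a disk of a function with vanishing circular
means that is transported by the flow is controlled by a boundary term and by the oscillation
of the function under radial shifts of size at most `1 / t`. -/
theorem abs_integral_ball_flow_le {f : Plane → ℝ} (hf : Measurable f) {B : ℝ}
    (hB : ∀ x, |f x| ≤ B) (hmean : ∀ᵐ x : Plane, ∫ s in (0 : ℝ)..1, f (rotate (2 * π * s) x) = 0)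
    {t ε E : ℝ} (ht : 0 < t) (hε : 0 ≤ ε) (x₀ : Plane)
    (hE : ∀ s ∈ Icc (0 : ℝ) 1, ∫ x in Metric.ball x₀ ε,
      |f (radialShift (s / t) (rotate (2 * π * s) (flow (-t) x))) -
        f (rotate (2 * π * s) (flow (-t) x))| ≤ E) :
    |∫ x in Metric.ball x₀ ε, f (flow (-t) x)| ≤
      2 * π * B * (2 * ε * t⁻¹ + t⁻¹ ^ 2) + E := by
  have hB0 : 0 ≤ B := (abs_nonneg _).trans (hB 0)
  have hfl : Measurable (flow (-t)) := (measurePreserving_flow (-t)).measurable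
  have hrot : ∀ a, Measurable (rotate a) := fun a => (measurePreserving_rotate a).measurable
  have hfin : IsFiniteMeasure (volume.restrict (Metric.ball x₀ ε)) :=
    isFiniteMeasure_restrict.2 measure_ball_lt_top.ne
  have hint : ∀ g : Plane → Plane, Measurable g →
      Integrable (fun x => f (g x)) (volume.restrict (Metric.ball x₀ ε)) := fun g hg =>
    Integrable.of_bound (hf.comp hg).aestronglyMeasurable B
      (Filter.Eventually.of_forall fun x => hB _)
  set I : ℝ := ∫ x in Metric.ball x₀ ε, f (flow (-t) x) with hI
  set D : ℝ := 2 * π * B * (2 * ε * t⁻¹ + t⁻¹ ^ 2) + E with hD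
  set g : ℝ → ℝ := fun s => ∫ x in Metric.ball x₀ ε, f (rotate (2 * π * s) (flow (-t) x)) with hg
  -- For each `s`: first insert the shift by `s / t` into the integral (boundary error), commute it
  -- past the flow, then remove it inside `f` (error `E`).
  have key : ∀ s ∈ Icc (0 : ℝ) 1, |I - g s| ≤ D := by
    intro s hs
    have hst : 0 ≤ s / t := div_nonneg hs.1 ht.le
    have hst' : s / t ≤ t⁻¹ := by
      rw [div_eq_mul_inv]; exact mul_le_of_le_one_left (by positivity) hs.2
    have h1 := abs_integral_ball_sub_integral_radialShift_le (hf.comp hfl) (fun x => hB _)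
      hst hε x₀
    simp only [Function.comp] at h1
    have h2 : ∫ x in Metric.ball x₀ ε, f (flow (-t) (radialShift (s / t) x)) =
        ∫ x in Metric.ball x₀ ε,
          f (radialShift (s / t) (rotate (2 * π * s) (flow (-t) x))) := by
      refine integral_congr_ae (ae_restrict_of_ae ?_)
      have h0 : ∀ᵐ x : Plane, x ≠ 0 := by simp [ae_iff]
      filter_upwards [h0] with x hx
      rw [flow_neg_radialShift hs.1 ht hx]
    rw [h2] at h1
    have h3 : |(∫ x in Metric.ball x₀ ε,
        f (radialShift (s / t) (rotate (2 * π * s) (flow (-t) x)))) - g s| ≤ E := by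
      have h5 := integral_sub
        (hint _ ((measurable_radialShift (s / t)).comp ((hrot (2 * π * s)).comp hfl)))
        (hint _ ((hrot (2 * π * s)).comp hfl))
      simp only [Function.comp] at h5
      rw [hg]
      simp only
      rw [← h5]
      exact abs_integral_le_integral_abs.trans (hE s hs)
    have h4 : 2 * π * B * (2 * ε * (s / t) + (s / t) ^ 2) ≤
        2 * π * B * (2 * ε * t⁻¹ + t⁻¹ ^ 2) := by
      gcongr
    rw [abs_le] at *
    constructor <;> linarith [h1.1, h1.2, h3.1, h3.2]
  have hmeas : Measurable fun p : ℝ × Plane => f (rotate (2 * π * p.1) (flow (-t) p.2)) := by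
    refine hf.comp (Measurable.comp (g := fun p : ℝ × Plane => rotate p.1 p.2)
      (f := fun p : ℝ × Plane => (2 * π * p.1, flow (-t) p.2)) continuous_rotate.measurable ?_)
    exact (measurable_fst.const_mul _).prodMk (hfl.comp measurable_snd)
  have hprod : Integrable (Function.uncurry fun (s : ℝ) (x : Plane) =>
      f (rotate (2 * π * s) (flow (-t) x)))
      ((volume.restrict (uIoc (0 : ℝ) 1)).prod (volume.restrict (Metric.ball x₀ ε))) := by
    have : IsFiniteMeasure (volume.restrict (uIoc (0 : ℝ) 1)) := ⟨by simp [uIoc]⟩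
    exact Integrable.of_bound hmeas.aestronglyMeasurable B
      (Filter.Eventually.of_forall fun x => hB _)
  -- After exchanging the integrals, the inner one is the circular mean of `f` through `flow (-t)
  -- x`; the exceptional null set pulls back to a null set under the flow.
  have hzero : ∫ s in (0 : ℝ)..1, g s = 0 := by
    rw [hg, intervalIntegral_integral_swap hprod]
    refine (integral_congr_ae (g := fun _ => 0) (ae_restrict_of_ae ?_)).trans (by simp)
    exact (measurePreserving_flow (-t)).quasiMeasurePreserving.ae hmean
  have hgi : IntervalIntegrable g volume 0 1 := by
    rw [intervalIntegrable_iff]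
    exact hprod.integral_prod_left
  have hfinal : I = ∫ s in (0 : ℝ)..1, (I - g s) := by
    rw [intervalIntegral.integral_sub (by simp) hgi, hzero]; simp
  rw [hfinal]
  have := intervalIntegral.norm_integral_le_of_norm_le_const (a := (0 : ℝ)) (b := 1) (C := D)
    (f := fun s => I - g s) (fun s hs => by
      rw [uIoc_of_le zero_le_one] at hs
      exact key s ⟨hs.1.le, hs.2⟩)
  simpa using this

/-- The part of a disk of radius `ε` in an annulus of width `h` has area `O(ε h)`. -/
theorem volume_ball_inter_annulus_le (x₀ : Plane) {ε h a : ℝ} (hε : 0 < ε) (hh : 0 ≤ h)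
    (ha : 0 ≤ a) :
    volume.real (Metric.ball x₀ ε ∩ {x | a ≤ ‖x‖ ∧ ‖x‖ ≤ a + h}) ≤ 4 * π * ε * h := by
  set U : Set Plane := Metric.ball x₀ ε ∩ {x | a ≤ ‖x‖ ∧ ‖x‖ ≤ a + h}
  -- Double counting: the outward shifts of the piece by `s ∈ (0, ε]` stay in the disk of radius
  -- `2ε` and have at least its area, while each point `y` lies in them only for `s` in an interval
  -- of length `h`. Hence `ε · |U| ≤ h · π (2ε)²`.
  let G : ℝ × Plane → ℝ≥0∞ := {p : ℝ × Plane | p.2 ∈ Metric.ball x₀ (2 * ε) ∧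
    p.1 ∈ Icc (‖p.2‖ - (a + h)) (‖p.2‖ - a)}.indicator 1
  have hGm : Measurable G := by
    refine measurable_one.indicator ?_
    refine MeasurableSet.inter (measurable_snd measurableSet_ball) ?_
    exact (measurableSet_le (f := fun p : ℝ × Plane => ‖p.2‖ - (a + h)) (g := fun p => p.1)
      (by fun_prop) (by fun_prop)).inter
      (measurableSet_le (f := fun p : ℝ × Plane => p.1) (g := fun p => ‖p.2‖ - a)
      (by fun_prop) (by fun_prop))
  have hUm : MeasurableSet U := by
    refine measurableSet_ball.inter (MeasurableSet.inter
      (measurableSet_le (f := fun _ : Plane => a) (g := fun x => ‖x‖) (by fun_prop) (by fun_prop))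
      (measurableSet_le (f := fun x : Plane => ‖x‖) (g := fun _ => a + h) (by fun_prop)
        (by fun_prop)))
  have h1 : ∀ s ∈ Ioc 0 ε, volume U ≤ ∫⁻ y, G (s, y) := by
    intro s hs
    refine le_trans ?_ (lintegral_radialShift_le hs.1.le (hGm.comp measurable_prodMk_left))
    rw [← lintegral_indicator_one hUm]
    have h0 : ∀ᵐ x : Plane, x ≠ 0 := by simp [ae_iff]
    refine lintegral_mono_ae (h0.mono fun x hx0 => ?_)
    by_cases hx : x ∈ U
    · have h2 : (s, radialShift s x) ∈ {p : ℝ × Plane | p.2 ∈ Metric.ball x₀ (2 * ε) ∧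
          p.1 ∈ Icc (‖p.2‖ - (a + h)) (‖p.2‖ - a)} := by
        have h3 := norm_radialShift_sub s x
        have h4 := hx.1
        have h5 : a ≤ ‖x‖ ∧ ‖x‖ ≤ a + h := hx.2
        rw [Metric.mem_ball, dist_eq_norm] at h4
        rw [abs_of_pos hs.1] at h3
        refine ⟨?_, ?_⟩
        · rw [Metric.mem_ball, dist_eq_norm]
          calc ‖radialShift s x - x₀‖ = ‖(radialShift s x - x) + (x - x₀)‖ := by congr 1; abel
            _ ≤ ‖radialShift s x - x‖ + ‖x - x₀‖ := norm_add_le _ _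
            _ < 2 * ε := by linarith [hs.2]
        · simp only
          rw [norm_radialShift hx0 (by linarith [hs.1])]
          constructor <;> linarith
      have h6 : G (s, radialShift s x) = 1 := indicator_of_mem h2 _
      rw [indicator_of_mem hx]
      exact h6.ge
    · simp [indicator_of_notMem hx]
  have h2 : ENNReal.ofReal ε * volume U ≤
      ENNReal.ofReal h * (ENNReal.ofReal (2 * ε) ^ 2 * ENNReal.ofReal π) := by
    calc ENNReal.ofReal ε * volume U = ∫⁻ s in Ioc 0 ε, volume U := by
          simp [mul_comm]
      _ ≤ ∫⁻ s in Ioc 0 ε, ∫⁻ y, G (s, y) := setLIntegral_mono' measurableSet_Ioc h1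
      _ ≤ ∫⁻ s, ∫⁻ y, G (s, y) := setLIntegral_le_lintegral _ _
      _ = ∫⁻ y, ∫⁻ s, G (s, y) := lintegral_lintegral_swap (f := fun s y => G (s, y))
          hGm.aemeasurable
      _ ≤ ∫⁻ y, (Metric.ball x₀ (2 * ε)).indicator (fun _ => ENNReal.ofReal h) y := by
          refine lintegral_mono fun y => ?_
          by_cases hy : y ∈ Metric.ball x₀ (2 * ε)
          · rw [indicator_of_mem hy]
            have : ∀ s, G (s, y) = (Icc (‖y‖ - (a + h)) (‖y‖ - a)).indicator 1 s := by
              intro s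
              simp only [G, indicator, mem_ofPred_eq, hy, true_and]
              split_ifs <;> rfl
            simp_rw [this]
            rw [lintegral_indicator_one measurableSet_Icc, Real.volume_Icc]
            apply le_of_eq; congr 1; ring
          · have : ∀ s, G (s, y) = 0 := by
              intro s
              simp only [G, indicator, mem_ofPred_eq, hy, false_and, if_false]
            simp [this]
      _ = _ := by
          rw [lintegral_indicator measurableSet_ball, setLIntegral_const,
            EuclideanSpace.volume_ball_fin_two]
  have h3 := ENNReal.toReal_mono (by finiteness) h2
  rw [ENNReal.toReal_mul, ENNReal.toReal_mul, ENNReal.toReal_mul, ENNReal.toReal_pow,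
    ENNReal.toReal_ofReal hε.le, ENNReal.toReal_ofReal hh, ENNReal.toReal_ofReal (by positivity),
    ENNReal.toReal_ofReal pi_nonneg] at h3
  have h4 : ε * volume.real U ≤ ε * (4 * π * ε * h) := by
    calc ε * volume.real U ≤ h * ((2 * ε) ^ 2 * π) := h3
      _ = _ := by ring
  exact le_of_mul_le_mul_left h4 hε

-- Bounded distributional solutions are transported by the flow

attribute [local irreducible] flow

/-- The origin is excluded because the angle involves `‖x‖`. This is why test functions are later
restricted to annuli, which the flow preserves. -/
theorem contDiffAt_flow_uncurry {p : ℝ × Plane} (hp : p.2 ≠ 0) :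
    ContDiffAt ℝ ∞ (fun p : ℝ × Plane => flow p.1 p.2) p := by
  have hn : ContDiffAt ℝ ∞ (fun p : ℝ × Plane => ‖p.2‖) p := contDiffAt_snd.norm ℝ hp
  have h0 : ContDiffAt ℝ ∞ (fun p : ℝ × Plane => p.2 0) p :=
    ((EuclideanSpace.proj (𝕜 := ℝ) (0 : Fin 2)).contDiff.contDiffAt).comp p contDiffAt_snd
  have h1 : ContDiffAt ℝ ∞ (fun p : ℝ × Plane => p.2 1) p :=
    ((EuclideanSpace.proj (𝕜 := ℝ) (1 : Fin 2)).contDiff.contDiffAt).comp p contDiffAt_snd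
  have ha : ContDiffAt ℝ ∞ (fun p : ℝ × Plane => -(2 * π * p.1 * ‖p.2‖)) p :=
    ((contDiffAt_const.mul contDiffAt_fst).mul hn).neg
  have hc := (contDiff_cos.contDiffAt (n := ∞)).comp p ha
  have hs := (contDiff_sin.contDiffAt (n := ∞)).comp p ha
  rw [contDiffAt_euclidean]
  intro i
  fin_cases i
  · simpa [flow, twist, rotate] using! (hc.mul h0).sub (hs.mul h1)
  · simpa [flow, twist, rotate] using! (hs.mul h0).add (hc.mul h1)

theorem hasDerivAt_flow (x : Plane) (c : ℝ) :
    HasDerivAt (fun t => flow (t - c) x) (velocity x) c := by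
  have ha : HasDerivAt (fun t : ℝ => -(2 * π * (t - c) * ‖x‖)) (-(2 * π * 1 * ‖x‖)) c :=
    ((((hasDerivAt_id c).sub_const c).const_mul (2 * π)).mul_const ‖x‖).neg
  have hc := ha.cos
  have hs := ha.sin
  have h1 : (fun t => flow (t - c) x) = fun t => cos (-(2 * π * (t - c) * ‖x‖)) • x +
      sin (-(2 * π * (t - c) * ‖x‖)) • !₂[-x 1, x 0] := by
    funext t
    ext i
    fin_cases i
    · simp [flow, twist, rotate]
    · simp [flow, twist, rotate]; ring
  have h2 := (hc.smul_const x).add (hs.smul_const !₂[-x 1, x 0])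
  rw [h1]
  refine h2.congr_deriv ?_
  ext i
  fin_cases i
  · simp [velocity]
  · simp [velocity]

/-- Test functions on the punctured unit disk, stably under the flow. -/
structure IsAnnularTest (ψ : Plane → ℝ) : Prop where
  contDiff : ContDiff ℝ ∞ ψ
  support : ∃ a b : ℝ, 0 < a ∧ b < 1 ∧ ∀ x, ψ x ≠ 0 → a ≤ ‖x‖ ∧ ‖x‖ ≤ b

theorem isAnnularTest_of_tsupport_subset {ψ : Plane → ℝ} (h : ContDiff ℝ ∞ ψ)
    (hc : HasCompactSupport ψ) (hs : tsupport ψ ⊆ unitDisk \ {0}) : IsAnnularTest ψ := by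
  refine ⟨h, ?_⟩
  rcases (tsupport ψ).eq_empty_or_nonempty with he | hne
  · refine ⟨1, 0, one_pos, one_pos, fun x hx => ?_⟩
    have : x ∈ tsupport ψ := subset_tsupport _ hx
    simp [he] at this
  · obtain ⟨p, hp, hpm⟩ := hc.isCompact.exists_isMinOn hne continuous_norm.continuousOn
    obtain ⟨q, hq, hqm⟩ := hc.isCompact.exists_isMaxOn hne continuous_norm.continuousOn
    refine ⟨‖p‖, ‖q‖, norm_pos_iff.2 fun h0 => (hs hp).2 (by simp [h0]), ?_, fun x hx => ?_⟩
    · simpa [unitDisk] using (hs hq).1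
    · exact ⟨hpm (subset_tsupport _ hx), hqm (subset_tsupport _ hx)⟩

namespace IsAnnularTest

variable {ψ : Plane → ℝ}

/-- The flow preserves norms, so near the origin the composite vanishes; away from it the flow
itself is smooth. -/
theorem contDiff_comp_flow (hψ : IsAnnularTest ψ) :
    ContDiff ℝ ∞ fun p : ℝ × Plane => ψ (flow (-p.1) p.2) := by
  obtain ⟨a, b, ha, -, hab⟩ := hψ.support
  rw [contDiff_iff_contDiffAt]
  intro p
  by_cases hp : p.2 = 0
  · have hU : {q : ℝ × Plane | ‖q.2‖ < a} ∈ nhds p :=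
      (isOpen_lt (by fun_prop) continuous_const).mem_nhds (by simpa [hp] using ha)
    refine (contDiffAt_const (c := (0 : ℝ))).congr_of_eventuallyEq ?_
    filter_upwards [hU] with q hq
    by_contra h
    have := (hab _ h).1
    rw [norm_flow] at this
    exact absurd hq (not_lt.2 this)
  · have h1 : ContDiffAt ℝ ∞ (fun p : ℝ × Plane => ((-p.1, p.2) : ℝ × Plane)) p := by
      fun_prop
    have h2 : ContDiffAt ℝ ∞ (fun p : ℝ × Plane => flow (-p.1) p.2) p :=
      ContDiffAt.comp (g := fun p : ℝ × Plane => flow p.1 p.2) p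
        (contDiffAt_flow_uncurry (p := (-p.1, p.2)) hp) h1
    exact hψ.contDiff.contDiffAt.comp p h2

theorem comp_flow (hψ : IsAnnularTest ψ) (t : ℝ) : IsAnnularTest fun x => ψ (flow t x) := by
  refine ⟨?_, ?_⟩
  · have h1 : ContDiff ℝ ∞ fun x : Plane => ((-t, x) : ℝ × Plane) := by fun_prop
    have h2 := hψ.contDiff_comp_flow.comp h1
    simp only [Function.comp_def, neg_neg] at h2
    exact h2
  · obtain ⟨a, b, ha, hb, hab⟩ := hψ.support
    exact ⟨a, b, ha, hb, fun x hx => by simpa [norm_flow] using hab _ hx⟩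

theorem tsupport_subset (hψ : IsAnnularTest ψ) :
    ∃ b, b < 1 ∧ tsupport ψ ⊆ Metric.closedBall 0 b := by
  obtain ⟨a, b, ha, hb, hab⟩ := hψ.support
  refine ⟨b, hb, closure_minimal (fun x hx => ?_) Metric.isClosed_closedBall⟩
  simpa using (hab x hx).2

theorem hasCompactSupport (hψ : IsAnnularTest ψ) : HasCompactSupport ψ := by
  obtain ⟨b, -, hb⟩ := hψ.tsupport_subset
  exact (isCompact_closedBall _ _).of_isClosed_subset (isClosed_tsupport _) hb

theorem tsupport_subset_unitDisk (hψ : IsAnnularTest ψ) : tsupport ψ ⊆ unitDisk := by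
  obtain ⟨b, hb1, hb⟩ := hψ.tsupport_subset
  exact hb.trans (Metric.closedBall_subset_ball hb1)

theorem exists_bound (hψ : IsAnnularTest ψ) : ∃ C, ∀ x, |ψ x| ≤ C :=
  hψ.contDiff.continuous.bounded_above_of_compact_support hψ.hasCompactSupport

end IsAnnularTest

theorem isFiniteMeasure_unitDisk : IsFiniteMeasure (volume.restrict unitDisk) :=
  isFiniteMeasure_restrict.2 measure_ball_lt_top.ne

/-- Space-time test functions transported by the flow. -/
theorem fderiv_transported {η : ℝ → ℝ} (hη : ContDiff ℝ ∞ η) {ψ : Plane → ℝ}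
    (hψ : IsAnnularTest ψ) (t : ℝ) (x : Plane) :
    fderiv ℝ (fun p : ℝ × Plane => η p.1 * ψ (flow (-p.1) p.2)) (t, x) (1, velocity x) =
      deriv η t * ψ (flow (-t) x) := by
  have hd : DifferentiableAt ℝ (fun p : ℝ × Plane => η p.1 * ψ (flow (-p.1) p.2)) (t, x) :=
    ((hη.comp contDiff_fst).mul hψ.contDiff_comp_flow).differentiable (by simp) _
  have hcurve : HasDerivAt (fun s : ℝ => ((s, flow (s - t) x) : ℝ × Plane)) (1, velocity x) t :=
    (hasDerivAt_id t).prodMk (hasDerivAt_flow x t)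
  have hbase : ((t, flow (t - t) x) : ℝ × Plane) = (t, x) := by simp [flow_zero]
  have h1 := HasFDerivAt.comp_hasDerivAt_of_eq t hd.hasFDerivAt hcurve hbase.symm
  -- Along the characteristic through `(t, x)` the factor with `ψ` is constant, so only `η` is
  -- differentiated.
  have h2 : ((fun p : ℝ × Plane => η p.1 * ψ (flow (-p.1) p.2)) ∘
      fun s : ℝ => ((s, flow (s - t) x) : ℝ × Plane)) = fun s => η s * ψ (flow (-t) x) := by
    funext s
    simp only [Function.comp, flow_flow]
    congr 3; ring
  rw [h2] at h1
  have h3 : HasDerivAt (fun s => η s * ψ (flow (-t) x)) (deriv η t * ψ (flow (-t) x)) t :=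
    ((hη.differentiable (by simp)) t).hasDerivAt.mul_const _
  exact h1.unique h3

/-- A continuous function on `[0, ∞)` that is orthogonal to all derivatives of test functions on
`[0, ∞)`, up to the boundary term of the constant `c`, is equal to `c`. -/
theorem eqOn_const_of_integral_deriv_mul {g : ℝ → ℝ} (hg : ContinuousOn g (Ici 0)) {c : ℝ}
    (h : ∀ η : ℝ → ℝ, ContDiff ℝ ∞ η → HasCompactSupport η →
      (∫ t in Ioi (0 : ℝ), deriv η t * g t) + c * η 0 = 0) :
    ∀ t, 0 ≤ t → g t = c := by
  have hli : LocallyIntegrableOn (fun t => g t - c) (Ioi 0) :=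
    ((hg.sub continuousOn_const).mono Ioi_subset_Ici_self).locallyIntegrableOn measurableSet_Ioi
  have hae := isOpen_Ioi.ae_eq_zero_of_integral_contDiff_smul_eq_zero hli (by
    intro χ hχ hχc hχs
    obtain ⟨b, hb0, hb⟩ : ∃ b, 0 ≤ b ∧ ∀ t, b ≤ t → χ t = 0 := by
      obtain ⟨b, hb⟩ := hχc.isCompact.bddAbove
      refine ⟨max b 0 + 1, by positivity, fun t ht => ?_⟩
      by_contra h0
      have := hb (subset_tsupport _ h0)
      linarith [le_max_left b 0]
    have hχ0 : ∀ t, t ≤ 0 → χ t = 0 := fun t ht => by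
      by_contra h0
      exact absurd (hχs (subset_tsupport _ h0)) (not_lt.2 ht)
    -- The primitive of `χ` that vanishes to the right of the support, so that testing with it
    -- recovers `∫ χ g`, with boundary value `-∫ χ` at `0`.
    set H : ℝ → ℝ := fun t => ∫ s in b..t, χ s with hH
    have hHd : ∀ t, HasDerivAt H (χ t) t := fun t =>
      intervalIntegral.integral_hasDerivAt_right (hχ.continuous.intervalIntegrable _ _)
        (hχ.continuous.stronglyMeasurableAtFilter _ _) hχ.continuous.continuousAt
    have hHs : ContDiff ℝ ∞ H := by
      rw [contDiff_infty_iff_deriv]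
      exact ⟨fun t => (hHd t).differentiableAt, by
        rw [show deriv H = χ from funext fun t => (hHd t).deriv]; exact hχ⟩
    have hHb : ∀ t, b ≤ t → H t = 0 := fun t ht => by
      rw [hH]
      simp only
      rw [intervalIntegral.integral_congr (g := fun _ => 0)]
      · simp
      · intro s hs
        rw [uIcc_of_le ht] at hs
        exact hb s hs.1
    -- A cutoff equal to `1` on `[0, ∞)` and to `0` on `(-∞, -1]`: it makes the primitive compactly
    -- supported without changing it at nonnegative times.
    set S : ℝ → ℝ := fun t => Real.smoothTransition (t + 1) with hS
    have hSs : ContDiff ℝ ∞ S := Real.smoothTransition.contDiff.comp (by fun_prop)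
    have hη := h (fun t => S t * H t) (hSs.mul hHs) (by
      refine HasCompactSupport.intro (isCompact_Icc (a := (-1 : ℝ)) (b := b)) fun t ht => ?_
      rw [mem_Icc, not_and_or, not_le, not_le] at ht
      rcases ht with ht | ht
      · simp [hS, Real.smoothTransition.zero_of_nonpos (by linarith : t + 1 ≤ 0)]
      · simp [hHb t ht.le])
    have hder : ∀ t ∈ Ioi (0 : ℝ), deriv (fun t => S t * H t) t * g t = χ t * g t := by
      intro t (ht : 0 < t)
      have : (fun t => S t * H t) =ᶠ[nhds t] H := by
        filter_upwards [isOpen_Ioi.mem_nhds ht] with s (hs : 0 < s)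
        simp [hS, Real.smoothTransition.one_of_one_le (by linarith : 1 ≤ s + 1)]
      rw [this.deriv_eq, (hHd t).deriv]
    rw [setIntegral_congr_fun measurableSet_Ioi hder] at hη
    have hη0 : S 0 * H 0 = -∫ t in Ioi (0 : ℝ), χ t := by
      have h1 : ∫ t in Ioi (0 : ℝ), χ t = ∫ t in (0 : ℝ)..b, χ t := by
        rw [intervalIntegral.integral_of_le hb0]
        refine (setIntegral_eq_of_subset_of_forall_sdiff_eq_zero measurableSet_Ioi
          Ioc_subset_Ioi_self fun t ht => hb t ?_)
        by_contra hlt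
        exact ht.2 ⟨ht.1, (not_le.1 hlt).le⟩
      rw [h1, hS, hH]
      simp only [zero_add, Real.smoothTransition.one, one_mul]
      rw [intervalIntegral.integral_symm]
    rw [hη0] at hη
    have hi1 : IntegrableOn (fun t => χ t * g t) (Ioi 0) := by
      refine Integrable.integrableOn ?_
      rw [← integrableOn_iff_integrable_of_support_subset (s := tsupport χ)]
      · exact ContinuousOn.integrableOn_compact hχc.isCompact
          (hχ.continuous.continuousOn.mul (hg.mono (hχs.trans Ioi_subset_Ici_self)))
      · intro t ht
        exact subset_tsupport _ (left_ne_zero_of_mul ht)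
    have hi2 : IntegrableOn χ (Ioi 0) :=
      (hχ.continuous.integrable_of_hasCompactSupport hχc).integrableOn
    rw [← setIntegral_eq_integral_of_forall_compl_eq_zero (s := Ioi (0 : ℝ))
      (fun t ht => by rw [hχ0 t (not_lt.1 ht), zero_smul])]
    simp only [smul_eq_mul, mul_sub]
    rw [integral_sub hi1 (hi2.mul_const c), integral_mul_const]
    linarith)
  have hIoi : ∀ t, 0 < t → g t = c := by
    intro t ht
    by_contra hne
    have hgt : ContinuousAt g t := hg.continuousAt (Ici_mem_nhds ht)
    have hU : {s | g s ≠ c} ∩ Ioi 0 ∈ nhds t :=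
      Filter.inter_mem (hgt.eventually_ne hne) (isOpen_Ioi.mem_nhds ht)
    have : volume ({s | g s ≠ c} ∩ Ioi 0) = 0 := by
      refine measure_mono_null (fun s hs => ?_) (ae_iff.1 hae)
      simp only [mem_ofPred_eq, Classical.not_imp]
      exact ⟨hs.2, sub_ne_zero.2 hs.1⟩
    exact (Measure.measure_pos_of_mem_nhds volume hU).ne' this
  intro t ht
  rcases ht.eq_or_lt with rfl | ht
  · have h1 : Filter.Tendsto g (nhdsWithin 0 (Ioi 0)) (nhds (g 0)) :=
      (hg 0 self_mem_Ici).mono_left (nhdsWithin_mono _ Ioi_subset_Ici_self)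
    refine tendsto_nhds_unique h1 (tendsto_const_nhds.congr' ?_)
    filter_upwards [self_mem_nhdsWithin] with s hs
    exact (hIoi s hs).symm
  · exact hIoi t ht

/-- Both factors move with `t`. With the test function frozen at `t₀`, weak continuity applies; the
change of the test function tends to zero in `L¹`, and `ρ` is uniformly bounded. -/
theorem IsSolution.continuousOn_pairing {ρ₀ : Plane → ℝ} {ρ : ℝ → Plane → ℝ}
    (h : IsSolution velocity ρ₀ ρ) {ψ : Plane → ℝ} (hψ : IsAnnularTest ψ) :
    ContinuousOn (fun t => ∫ x in unitDisk, ρ t x * ψ (flow (-t) x)) (Ici 0) := by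
  have hfin := isFiniteMeasure_unitDisk
  obtain ⟨M, hM⟩ := h.bounded
  have hM0 : 0 ≤ M := by
    have : (volume.restrict unitDisk) ≠ 0 := by
      rw [Ne, Measure.restrict_eq_zero]
      exact (Metric.measure_ball_pos volume (0 : Plane) one_pos).ne'
    have := ae_neBot.2 this
    obtain ⟨x, hx⟩ := (hM 0 le_rfl).exists
    exact (abs_nonneg _).trans hx
  obtain ⟨C, hC⟩ := hψ.exists_bound
  have hcont : Continuous fun p : ℝ × Plane => ψ (flow (-p.1) p.2) :=
    hψ.contDiff_comp_flow.continuous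
  have hcx : ∀ t, Continuous fun x => ψ (flow (-t) x) := fun t => by
    have := hcont.comp (Continuous.prodMk_right t); exact this
  have hint : ∀ t, 0 ≤ t → ∀ φ : Plane → ℝ, Continuous φ → (∃ C, ∀ x, |φ x| ≤ C) →
      Integrable (fun x => ρ t x * φ x) (volume.restrict unitDisk) := by
    rintro t ht φ hφ ⟨C, hC⟩
    refine Integrable.of_bound ((h.measurable_slice t ht).mul hφ.aestronglyMeasurable) (M * C) ?_
    filter_upwards [hM t ht] with x hx
    rw [norm_mul]
    exact mul_le_mul hx (hC x) (norm_nonneg _) hM0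
  intro t₀ ht₀
  have hmain : Filter.Tendsto (fun t => ∫ x in unitDisk, ρ t x * ψ (flow (-t₀) x))
      (nhdsWithin t₀ (Ici 0)) (nhds (∫ x in unitDisk, ρ t₀ x * ψ (flow (-t₀) x))) :=
    h.weakly_continuous _ (hψ.comp_flow (-t₀)).contDiff (hψ.comp_flow (-t₀)).hasCompactSupport
      (hψ.comp_flow (-t₀)).tsupport_subset_unitDisk t₀ ht₀
  have herr : Filter.Tendsto (fun t => M * ∫ x in unitDisk,
      |ψ (flow (-t) x) - ψ (flow (-t₀) x)|) (nhdsWithin t₀ (Ici 0)) (nhds 0) := by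
    have h1 : Continuous fun t => ∫ x in unitDisk, |ψ (flow (-t) x) - ψ (flow (-t₀) x)| := by
      refine continuous_of_dominated (bound := fun _ => C + C) (fun t => ?_) (fun t => ?_)
        (integrable_const _) ?_
      · exact ((hcx t).sub (hcx t₀)).abs.aestronglyMeasurable
      · refine Filter.Eventually.of_forall fun x => ?_
        rw [norm_abs_eq_norm]
        exact (norm_sub_le _ _).trans (add_le_add (hC _) (hC _))
      · refine Filter.Eventually.of_forall fun x => ?_
        have : Continuous fun t => ψ (flow (-t) x) := hcont.comp (Continuous.prodMk_left x)
        exact (this.sub continuous_const).abs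
    have h2 := ((h1.tendsto t₀).const_mul M).mono_left (nhdsWithin_le_nhds (s := Ici 0))
    simpa using h2
  have hdiff : Filter.Tendsto (fun t => (∫ x in unitDisk, ρ t x * ψ (flow (-t) x)) -
      ∫ x in unitDisk, ρ t x * ψ (flow (-t₀) x)) (nhdsWithin t₀ (Ici 0)) (nhds 0) := by
    refine squeeze_zero_norm' ?_ herr
    filter_upwards [self_mem_nhdsWithin] with t ht
    rw [← integral_sub (hint t ht _ (hcx t) ⟨C, fun x => hC _⟩)
      (hint t ht _ (hcx t₀) ⟨C, fun x => hC _⟩), ← integral_const_mul]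
    refine norm_integral_le_of_norm_le ?_ ?_
    · refine Integrable.const_mul ?_ M
      refine Integrable.of_bound ((hcx t).sub (hcx t₀)).abs.aestronglyMeasurable (C + C) ?_
      refine Filter.Eventually.of_forall fun x => ?_
      rw [norm_abs_eq_norm]
      exact (norm_sub_le _ _).trans (add_le_add (hC _) (hC _))
    · filter_upwards [hM t ht] with x hx
      rw [← mul_sub, norm_mul]
      exact mul_le_mul_of_nonneg_right hx (abs_nonneg _)
  have := hdiff.add hmain
  simpa [ContinuousWithinAt] using this

/-- Bounded distributional solutions are transported by the flow. -/
theorem IsSolution.ae_eq_comp_flow {ρ₀ : Plane → ℝ} {ρ : ℝ → Plane → ℝ}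
    (hρ₀ : MemLp ρ₀ ⊤ volume) (h : IsSolution velocity ρ₀ ρ) {t : ℝ} (ht : 0 ≤ t) :
    ρ t =ᵐ[volume.restrict unitDisk] fun x => ρ₀ (flow (-t) x) := by
  have hfin := isFiniteMeasure_unitDisk
  obtain ⟨M, hM⟩ := h.bounded
  have hpair : ∀ ψ : Plane → ℝ, IsAnnularTest ψ → ∀ t, 0 ≤ t →
      ∫ x in unitDisk, ρ t x * ψ (flow (-t) x) = ∫ x in unitDisk, ρ₀ x * ψ x := by
    intro ψ hψ
    refine eqOn_const_of_integral_deriv_mul (h.continuousOn_pairing hψ) ?_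
    intro η hη hηc
    obtain ⟨b, hb1, hb⟩ := hψ.tsupport_subset
    have hsupp : ∀ p : ℝ × Plane, η p.1 * ψ (flow (-p.1) p.2) ≠ 0 →
        p ∈ tsupport η ×ˢ Metric.closedBall (0 : Plane) b := by
      intro p hp
      refine ⟨subset_tsupport _ (left_ne_zero_of_mul hp), ?_⟩
      have := hb (subset_tsupport _ (right_ne_zero_of_mul hp))
      simpa [norm_flow] using this
    have hts : tsupport (fun p : ℝ × Plane => η p.1 * ψ (flow (-p.1) p.2)) ⊆
        tsupport η ×ˢ Metric.closedBall (0 : Plane) b :=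
      closure_minimal hsupp ((isClosed_tsupport _).prod Metric.isClosed_closedBall)
    have hw := h.weak_equation (fun p => η p.1 * ψ (flow (-p.1) p.2))
      ((hη.comp contDiff_fst).mul hψ.contDiff_comp_flow)
      ((hηc.isCompact.prod (isCompact_closedBall _ _)).of_isClosed_subset
        (isClosed_tsupport _) hts)
      (hts.trans (prod_mono (subset_univ _) (Metric.closedBall_subset_ball hb1)))
    simp only [fderiv_transported hη hψ] at hw
    refine Eq.trans ?_ hw
    refine congrArg₂ (· + ·) ?_ ?_
    · refine integral_congr_ae (Filter.Eventually.of_forall fun t => ?_)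
      simp only
      rw [← integral_const_mul]
      refine integral_congr_ae (Filter.Eventually.of_forall fun x => ?_)
      simp only; ring
    · rw [mul_comm, ← integral_const_mul]
      refine integral_congr_ae (Filter.Eventually.of_forall fun x => ?_)
      simp only [neg_zero, flow_zero]; ring
  have hflow := measurePreserving_flow
  have hpre : ∀ t, flow t ⁻¹' unitDisk = unitDisk := fun t => by
    ext x; simp [unitDisk, norm_flow]
  have hρt : MemLp (fun x => ρ₀ (flow (-t) x)) ⊤ volume := hρ₀.comp_measurePreserving (hflow _)
  have hint1 : IntegrableOn (ρ t) unitDisk :=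
    Integrable.of_bound (h.measurable_slice t ht) M (hM t ht)
  have hint2 : IntegrableOn (fun x => ρ₀ (flow (-t) x)) unitDisk :=
    (hρt.restrict unitDisk).integrable le_top
  have hopen : IsOpen (unitDisk \ {0}) := Metric.isOpen_ball.sdiff isClosed_singleton
  have key := hopen.ae_eq_zero_of_integral_contDiff_smul_eq_zero (f := ρ t - fun x => ρ₀ (flow (-t) x))
    (((hint1.sub hint2).mono_set sdiff_subset).locallyIntegrableOn) (μ := volume) (by
    intro χ hχ hχc hχs
    have hT := isAnnularTest_of_tsupport_subset hχ hχc hχs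
    obtain ⟨C, hC⟩ := hT.exists_bound
    -- Testing with `χ ∘ flow t` cancels the flow at time `t`, leaving `χ` itself against `ρ t`.
    have h1 := hpair _ (hT.comp_flow t) t ht
    simp only [flow_flow, add_neg_cancel, flow_zero] at h1
    have h2 : ∫ x in unitDisk, ρ₀ x * χ (flow t x) =
        ∫ x in unitDisk, ρ₀ (flow (-t) x) * χ x := by
      have h3 := (hflow (-t)).restrict_preimage (s := unitDisk) Metric.isOpen_ball.measurableSet
      rw [hpre] at h3
      have hm : AEStronglyMeasurable (fun x => ρ₀ x * χ (flow t x)) (volume.restrict unitDisk) :=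
        (hρ₀.restrict unitDisk).aestronglyMeasurable.mul
          (hT.comp_flow t).contDiff.continuous.aestronglyMeasurable
      have h4 := integral_map (f := fun x => ρ₀ x * χ (flow t x)) h3.aemeasurable
        (by rw [h3.map_eq]; exact hm)
      rw [h3.map_eq] at h4
      simpa only [flow_flow, add_neg_cancel, flow_zero] using h4
    have hz : ∀ x, x ∉ unitDisk → χ x • ((ρ t - fun x => ρ₀ (flow (-t) x)) x) = 0 := by
      intro x hx
      rw [image_eq_zero_of_notMem_tsupport fun h => hx (hχs h).1, zero_smul]
    rw [← setIntegral_eq_integral_of_forall_compl_eq_zero hz]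
    simp only [Pi.sub_apply, smul_eq_mul, mul_sub]
    have hb : ∀ᵐ x ∂(volume.restrict unitDisk), ‖χ x‖ ≤ C := Filter.Eventually.of_forall hC
    rw [integral_sub (hint1.bdd_mul hχ.continuous.aestronglyMeasurable hb)
      (hint2.bdd_mul hχ.continuous.aestronglyMeasurable hb)]
    simp_rw [mul_comm (χ _)]
    rw [h1, h2, sub_self])
  have h0 : ∀ᵐ x : Plane, x ≠ 0 := by simp [ae_iff]
  rw [Filter.EventuallyEq, ae_restrict_iff' (show MeasurableSet unitDisk from measurableSet_ball)]
  filter_upwards [key, h0] with x hx hx0 hxU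
  exact sub_eq_zero.1 (hx ⟨hxU, hx0⟩)

/-! ### Lipschitz bound for the flow and the mixing scale in terms of the datum -/

theorem measurableSet_unitDisk : MeasurableSet unitDisk := measurableSet_ball

theorem flow_preimage_unitDisk (t : ℝ) : flow t ⁻¹' unitDisk = unitDisk := by
  ext x; simp [unitDisk, norm_flow]

theorem measurePreserving_flow_unitDisk (t : ℝ) :
    MeasurePreserving (flow t) (volume.restrict unitDisk) (volume.restrict unitDisk) := by
  have h := (measurePreserving_flow t).restrict_preimage measurableSet_unitDisk
  rwa [flow_preimage_unitDisk] at h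

theorem norm_rotate_sub_rotate_le (a b : ℝ) (x : Plane) :
    ‖rotate a x - rotate b x‖ ≤ |a - b| * ‖x‖ := by
  -- The chord length; `1 - u² / 2 ≤ cos u` then bounds the chord by the arc.
  have h1 : ‖rotate a x - rotate b x‖ ^ 2 = (2 - 2 * cos (a - b)) * ‖x‖ ^ 2 := by
    rw [EuclideanSpace.real_norm_sq_eq, EuclideanSpace.real_norm_sq_eq, cos_sub]
    simp only [Fin.sum_univ_two, rotate, PiLp.sub_apply]
    simp
    nlinarith [sin_sq_add_cos_sq a, sin_sq_add_cos_sq b, congrArg (fun r => r * (x 0 ^ 2 + x 1 ^ 2))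
      (sin_sq_add_cos_sq a), congrArg (fun r => r * (x 0 ^ 2 + x 1 ^ 2))
      (sin_sq_add_cos_sq b)]
  have h2 := one_sub_sq_div_two_le_cos (x := a - b)
  refine le_of_sq_le_sq ?_ (by positivity)
  rw [h1, mul_pow, sq_abs]
  exact mul_le_mul_of_nonneg_right (by linarith) (by positivity)

/-- Rotating `x` and `y` by the same angle is an isometry; the angles differ by at most `2π|t|‖x -
y‖`, and this difference acts at radius `‖y‖`. The resulting linear growth in `t` limits the mixing
rate. -/
theorem norm_flow_sub_flow_le (t : ℝ) (x y : Plane) :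
    ‖flow t x - flow t y‖ ≤ (1 + 2 * π * |t| * ‖y‖) * ‖x - y‖ := by
  have hx : flow t x = rotate (-(2 * π * t * ‖x‖)) x := by unfold flow; rfl
  have hy : flow t y = rotate (-(2 * π * t * ‖y‖)) y := by unfold flow; rfl
  rw [hx, hy]
  set a := -(2 * π * t * ‖x‖) with ha
  set b := -(2 * π * t * ‖y‖) with hb
  have h1 : rotate a x - rotate b y = rotate a (x - y) + (rotate a y - rotate b y) := by
    ext i
    fin_cases i
    · simp [rotate]; ring
    · simp [rotate]; ring
  have h2 : |a - b| ≤ 2 * π * |t| * ‖x - y‖ := by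
    have : a - b = -(2 * π * t) * (‖x‖ - ‖y‖) := by rw [ha, hb]; ring
    rw [this, abs_mul, abs_neg, abs_mul, abs_of_pos (by positivity : 0 < 2 * π)]
    exact mul_le_mul_of_nonneg_left (abs_norm_sub_norm_le x y) (by positivity)
  calc ‖rotate a x - rotate b y‖ ≤ ‖rotate a (x - y)‖ + ‖rotate a y - rotate b y‖ := by
        rw [h1]; exact norm_add_le _ _
    _ ≤ ‖x - y‖ + (2 * π * |t| * ‖x - y‖) * ‖y‖ := by
        rw [norm_rotate]
        have := norm_rotate_sub_rotate_le a b y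
        have h3 := mul_le_mul_of_nonneg_right h2 (norm_nonneg y)
        linarith
    _ = _ := by ring

theorem IsSolution.linftyNorm_eq {ρ₀ : Plane → ℝ} {ρ : ℝ → Plane → ℝ}
    (hρ₀ : MemLp ρ₀ ⊤ volume) (h : IsSolution velocity ρ₀ ρ) {t : ℝ} (ht : 0 ≤ t) :
    linftyNorm (ρ t) = linftyNorm ρ₀ := by
  rw [linftyNorm, linftyNorm, eLpNorm_congr_ae (h.ae_eq_comp_flow hρ₀ ht)]
  congr 1
  exact eLpNorm_comp_measurePreserving (hρ₀.restrict unitDisk).aestronglyMeasurable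
    (measurePreserving_flow_unitDisk (-t))

theorem IsInitialDatum.ae_norm_le {ρ₀ : Plane → ℝ} (h : IsInitialDatum ρ₀) :
    ∀ᵐ x ∂(volume.restrict unitDisk), |ρ₀ x| ≤ linftyNorm ρ₀ := by
  have h1 := (h.bounded.restrict unitDisk).eLpNorm_lt_top
  filter_upwards [ae_le_eLpNormEssSup (f := ρ₀) (μ := volume.restrict unitDisk)] with x hx
  rw [eLpNorm_exponent_top] at h1
  have := ENNReal.toReal_mono h1.ne hx
  simpa [linftyNorm, eLpNorm_exponent_top] using this

theorem linftyNorm_nonneg (f : Plane → ℝ) : 0 ≤ linftyNorm f := ENNReal.toReal_nonneg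

theorem ae_notMem_sphere : ∀ᵐ x : Plane, x ∉ Metric.sphere (0 : Plane) 1 := by
  rw [ae_iff]
  simp only [not_not]
  exact Measure.addHaar_sphere volume 0 1

/-- The transported datum, extended by zero. -/
theorem IsSolution.indicator_ae_eq {ρ₀ f : Plane → ℝ} {ρ : ℝ → Plane → ℝ}
    (hρ₀ : IsInitialDatum ρ₀) (h : IsSolution velocity ρ₀ ρ) (hf : f =ᵐ[volume] ρ₀)
    {t : ℝ} (ht : 0 ≤ t) :
    unitDisk.indicator (ρ t) =ᵐ[volume] fun x => f (flow (-t) x) := by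
  have h1 := h.ae_eq_comp_flow hρ₀.bounded ht
  rw [Filter.EventuallyEq, ae_restrict_iff' measurableSet_unitDisk] at h1
  have h2 := (measurePreserving_flow (-t)).quasiMeasurePreserving.ae hf
  filter_upwards [h1, h2, ae_notMem_sphere] with x hx1 hx2 hx3
  rw [hx2]
  by_cases hx : x ∈ unitDisk
  · rw [indicator_of_mem hx, hx1 hx]
  · rw [indicator_of_notMem hx, hρ₀.zero_outside]
    simp only [unitDisk, Metric.mem_ball, Metric.mem_sphere, Metric.mem_closedBall,
      dist_zero_right, norm_flow] at *
    intro h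
    exact hx3 (le_antisymm h (not_lt.1 hx))

theorem average_ball_eq (g : Plane → ℝ) (x : Plane) {ε : ℝ} (hε : 0 ≤ ε) :
    ⨍ y in Metric.ball x ε, g y = (π * ε ^ 2)⁻¹ * ∫ y in Metric.ball x ε, g y := by
  rw [setAverage_eq, volume_real_ball_plane x hε, smul_eq_mul]

/-- The flow preserves area and the disk, so the sup norm in the threshold is that of the datum at
all times. Any representative `f` may be used. -/
theorem IsSolution.geometricMixingScale_eq {ρ₀ f : Plane → ℝ} {ρ : ℝ → Plane → ℝ}
    (hρ₀ : IsInitialDatum ρ₀) (h : IsSolution velocity ρ₀ ρ) (hf : f =ᵐ[volume] ρ₀)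
    {t : ℝ} (ht : 0 ≤ t) (κ : ℝ) :
    geometricMixingScale κ (ρ t) = sInf {ε : ℝ | 0 < ε ∧ ∀ x : Plane,
      |∫ y in Metric.ball x ε, f (flow (-t) y)| ≤ κ * linftyNorm ρ₀ * (π * ε ^ 2)} := by
  rw [geometricMixingScale]
  congr 1
  ext ε
  simp only [mem_ofPred_eq]
  refine and_congr_right fun hε => forall_congr' fun x => ?_
  have hp : 0 < π * ε ^ 2 := by positivity
  rw [h.linftyNorm_eq hρ₀.bounded ht, average_ball_eq _ _ hε.le,
    setIntegral_congr_ae measurableSet_ball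
      ((h.indicator_ae_eq hρ₀ hf ht).mono fun y hy _ => hy), abs_mul, abs_inv, abs_of_pos hp,
    inv_mul_le_iff₀ hp, mul_comm (π * ε ^ 2)]

theorem IsSolution.geometricMixingScale_le {ρ₀ f : Plane → ℝ} {ρ : ℝ → Plane → ℝ}
    (hρ₀ : IsInitialDatum ρ₀) (h : IsSolution velocity ρ₀ ρ) (hf : f =ᵐ[volume] ρ₀)
    {t : ℝ} (ht : 0 ≤ t) {κ ε : ℝ} (hε : 0 < ε) (hb : ∀ x : Plane,
      |∫ y in Metric.ball x ε, f (flow (-t) y)| ≤ κ * linftyNorm ρ₀ * (π * ε ^ 2)) :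
    geometricMixingScale κ (ρ t) ≤ ε := by
  rw [h.geometricMixingScale_eq hρ₀ hf ht]
  exact csInf_le ⟨0, fun e he => he.1.le⟩ ⟨hε, hb⟩

theorem IsSolution.geometricMixingScale_le_of_linftyNorm_eq_zero {ρ₀ : Plane → ℝ}
    {ρ : ℝ → Plane → ℝ} (hρ₀ : IsInitialDatum ρ₀) (h : IsSolution velocity ρ₀ ρ)
    (h0 : linftyNorm ρ₀ = 0) {t : ℝ} (ht : 0 ≤ t) {κ ε : ℝ} (hε : 0 < ε) :
    geometricMixingScale κ (ρ t) ≤ ε := by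
  have hf : (fun _ => (0 : ℝ)) =ᵐ[volume] ρ₀ := by
    have h1 := hρ₀.ae_norm_le
    rw [ae_restrict_iff' measurableSet_unitDisk] at h1
    filter_upwards [h1, ae_notMem_sphere] with x hx hxs
    by_cases hxd : x ∈ unitDisk
    · have := hx hxd
      rw [h0] at this
      exact (abs_nonpos_iff.1 this).symm
    · refine (hρ₀.zero_outside x fun hc => ?_).symm
      simp only [unitDisk, Metric.mem_ball, Metric.mem_sphere, Metric.mem_closedBall] at *
      exact hxs (le_antisymm hc (not_lt.1 hxd))
  refine h.geometricMixingScale_le hρ₀ hf ht hε fun x => ?_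
  simp [h0]

/-! ### Continuous data: upper and lower bounds of order `1 / t` -/

section Continuous

variable {ρ₀ : Plane → ℝ}

open scoped Classical in
theorem IsInitialDatum.measurable_of_continuousOn (h : IsInitialDatum ρ₀)
    (hc : ContinuousOn ρ₀ (Metric.closedBall 0 1)) : Measurable ρ₀ := by
  have h1 : ρ₀ = (Metric.closedBall (0 : Plane) 1).piecewise ρ₀ 0 := by
    funext x
    by_cases hx : x ∈ Metric.closedBall (0 : Plane) 1
    · rw [piecewise_eq_of_mem _ _ _ hx]
    · rw [piecewise_eq_of_notMem _ _ _ hx, h.zero_outside x hx]; rfl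
  rw [h1]
  exact hc.measurable_piecewise continuousOn_const measurableSet_closedBall

/-- An almost everywhere bound for continuous data holds everywhere. -/
theorem IsInitialDatum.abs_le_of_ae (h : IsInitialDatum ρ₀)
    (hc : ContinuousOn ρ₀ (Metric.closedBall 0 1)) {b : ℝ} (hb : 0 ≤ b)
    (hae : ∀ᵐ x ∂(volume.restrict unitDisk), |ρ₀ x| ≤ b) (x : Plane) : |ρ₀ x| ≤ b := by
  have hopen : ∀ x ∈ unitDisk, |ρ₀ x| ≤ b := by
    intro x hx
    by_contra hlt
    have hcx : ContinuousAt ρ₀ x :=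
      hc.continuousAt (Filter.mem_of_superset (Metric.isOpen_ball.mem_nhds hx)
        Metric.ball_subset_closedBall)
    have hU : {y | b < |ρ₀ y|} ∩ unitDisk ∈ nhds x :=
      Filter.inter_mem (hcx.abs.eventually (lt_mem_nhds (not_le.1 hlt)))
        (Metric.isOpen_ball.mem_nhds hx)
    rw [ae_restrict_iff' measurableSet_unitDisk] at hae
    refine (Measure.measure_pos_of_mem_nhds volume hU).ne'
      (measure_mono_null (fun y hy => ?_) (ae_iff.1 hae))
    simp only [mem_ofPred_eq, Classical.not_imp]
    exact ⟨hy.2, not_le.2 hy.1⟩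
  by_cases hx : x ∈ Metric.closedBall (0 : Plane) 1
  · have hcl : closure unitDisk = Metric.closedBall (0 : Plane) 1 :=
      closure_ball _ one_ne_zero
    refine ContinuousWithinAt.closure_le (s := unitDisk) (f := fun x => |ρ₀ x|)
      (g := fun _ => b) (x := x) (by rwa [hcl]) ?_ continuousWithinAt_const hopen
    exact ((hc x hx).mono Metric.ball_subset_closedBall).abs
  · rw [h.zero_outside x hx]; simpa using hb

theorem IsInitialDatum.abs_le_linftyNorm (h : IsInitialDatum ρ₀)
    (hc : ContinuousOn ρ₀ (Metric.closedBall 0 1)) (x : Plane) : |ρ₀ x| ≤ linftyNorm ρ₀ :=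
  h.abs_le_of_ae hc (linftyNorm_nonneg _) h.ae_norm_le x

/-- Mixing at the rate `1 / t` for continuous data. -/
theorem IsInitialDatum.exists_geometricMixingScale_le (h : IsInitialDatum ρ₀)
    (hc : ContinuousOn ρ₀ (Metric.closedBall 0 1)) {κ : ℝ} (hκ : 0 < κ) (hκ1 : κ < 1) :
    ∃ C' : ℝ, 0 < C' ∧ ∀ ρ : ℝ → Plane → ℝ, IsSolution velocity ρ₀ ρ →
      ∀ t : ℝ, C' ≤ t → geometricMixingScale κ (ρ t) ≤ 28 / κ ^ 2 * t⁻¹ := by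
  set B := linftyNorm ρ₀ with hBdef
  rcases (linftyNorm_nonneg ρ₀).eq_or_lt with h0 | hB
  · refine ⟨1, one_pos, fun ρ hρ t ht => ?_⟩
    have ht0 : 0 < t := by linarith
    exact hρ.geometricMixingScale_le_of_linftyNorm_eq_zero h h0.symm ht0.le (by positivity)
  rw [← hBdef] at hB
  have huc := (isCompact_closedBall (0 : Plane) 1).uniformContinuousOn_of_continuous hc
  -- Half of the admissible average `κ B` is spent on the oscillation; the other half pays for the
  -- boundary terms.
  obtain ⟨δ, hδ, hδc⟩ := Metric.uniformContinuousOn_iff_le.1 huc (κ * B / 2) (by positivity)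
  refine ⟨max δ⁻¹ 1, by positivity, fun ρ hρ t ht => ?_⟩
  have ht1 : 1 ≤ t := (le_max_right _ _).trans ht
  replace ht : δ⁻¹ ≤ t := (le_max_left _ _).trans ht
  have ht0 : 0 < t := by linarith
  have hh : 0 < t⁻¹ := by positivity
  have hhδ : t⁻¹ ≤ δ := inv_le_of_inv_le₀ hδ ht
  set ε := 28 / κ ^ 2 * t⁻¹ with hεdef
  have hε : 0 < ε := by positivity
  have habs := h.abs_le_linftyNorm hc
  rw [← hBdef] at habs
  have hmeas := h.measurable_of_continuousOn hc
  refine hρ.geometricMixingScale_le h (Filter.EventuallyEq.refl _ ρ₀) ht0.le hε fun x₀ => ?_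
  have hmain := abs_integral_ball_flow_le hmeas habs
    (ae_integral_rotate_eq_zero h.circle_average) ht0 hε.le x₀
    (E := κ * B / 2 * (π * ε ^ 2) + 2 * B * (4 * π * ε * t⁻¹)) ?_
  · refine hmain.trans ?_
    have hkε : t⁻¹ = κ ^ 2 * ε / 28 := by rw [hεdef]; field_simp
    rw [← hBdef, hkε]
    have hk2 : κ ^ 2 ≤ κ := by nlinarith
    have hk4 : (κ ^ 2) ^ 2 ≤ κ := by nlinarith
    -- The `12` is `4` from the boundary of the disk plus `8` from the layer along the unit circle.
    -- The constant `28` suffices because `12/28 + 2/28² < 1/2`.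
    have h1 : 2 * π * B * (2 * ε * (κ ^ 2 * ε / 28) + (κ ^ 2 * ε / 28) ^ 2) +
        (κ * B / 2 * (π * ε ^ 2) + 2 * B * (4 * π * ε * (κ ^ 2 * ε / 28))) =
        B * (π * ε ^ 2) * (κ ^ 2 * (12 / 28) + (κ ^ 2) ^ 2 * (2 / 28 ^ 2) + κ / 2) := by ring
    rw [h1]
    have h2 : κ * B * (π * ε ^ 2) = B * (π * ε ^ 2) * κ := by ring
    rw [h2]
    refine mul_le_mul_of_nonneg_left ?_ (by positivity)
    nlinarith
  · intro s hs
    have hfin : IsFiniteMeasure (volume.restrict (Metric.ball x₀ ε)) :=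
      isFiniteMeasure_restrict.2 measure_ball_lt_top.ne
    -- Only from this layer can a shift by at most `t⁻¹` cross the unit circle, where `ρ₀` may jump;
    -- there the trivial bound `2B` is used. Outside the unit disk both values vanish.
    set A : Set Plane := {x | 1 - t⁻¹ ≤ ‖x‖ ∧ ‖x‖ ≤ 1} with hA
    have hAm : MeasurableSet A := MeasurableSet.inter
      (measurableSet_le (f := fun _ : Plane => 1 - t⁻¹) (g := fun x => ‖x‖) (by fun_prop)
        (by fun_prop))
      (measurableSet_le (f := fun x : Plane => ‖x‖) (g := fun _ => 1) (by fun_prop) (by fun_prop))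
    have hst : 0 ≤ s / t := div_nonneg hs.1 ht0.le
    have hst' : s / t ≤ t⁻¹ := by
      rw [div_eq_mul_inv]; exact mul_le_of_le_one_left (by positivity) hs.2
    have hpt : ∀ x : Plane, |ρ₀ (radialShift (s / t) (rotate (2 * π * s) (flow (-t) x))) -
        ρ₀ (rotate (2 * π * s) (flow (-t) x))| ≤
        κ * B / 2 + 2 * B * A.indicator 1 x := by
      intro x
      set z := rotate (2 * π * s) (flow (-t) x) with hz
      have hzx : ‖z‖ = ‖x‖ := by rw [hz, norm_rotate, norm_flow]
      have hTz := norm_radialShift_sub (s / t) z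
      rw [abs_of_nonneg hst] at hTz
      by_cases hxA : x ∈ A
      · rw [indicator_of_mem hxA]
        simp only [Pi.one_apply, mul_one]
        have h1 := habs (radialShift (s / t) z)
        have h2 := habs z
        have h3 := abs_sub (ρ₀ (radialShift (s / t) z)) (ρ₀ z)
        have : 0 ≤ κ * B / 2 := by positivity
        linarith
      · rw [indicator_of_notMem hxA, mul_zero, add_zero]
        rw [hA, mem_ofPred_eq, not_and_or, not_le, not_le] at hxA
        have hball : ∀ y : Plane, y ∈ Metric.closedBall (0 : Plane) 1 ↔ ‖y‖ ≤ 1 := by simp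
        rcases hxA with hx | hx
        · have h1 : ‖radialShift (s / t) z‖ ≤ 1 := by
            have := norm_le_norm_add_norm_sub' (radialShift (s / t) z) z
            linarith
          have := hδc _ ((hball _).2 h1) z ((hball _).2 (by linarith))
            (by rw [dist_eq_norm]; linarith)
          rwa [Real.dist_eq] at this
        · have hz0 : z ≠ 0 := by
            rw [← norm_pos_iff]; linarith
          rw [h.zero_outside z (by rw [hball]; linarith), h.zero_outside (radialShift (s / t) z)
            (by rw [hball, norm_radialShift hz0 (by positivity)]; linarith)]
          simp only [sub_self, abs_zero]; positivity
    have hind : Integrable (A.indicator (1 : Plane → ℝ)) (volume.restrict (Metric.ball x₀ ε)) :=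
      (integrable_const (1 : ℝ)).indicator hAm
    refine (integral_mono_of_nonneg (Filter.Eventually.of_forall fun x => abs_nonneg _)
      ((integrable_const _).add (hind.const_mul _)) (Filter.Eventually.of_forall hpt)).trans ?_
    simp only [Pi.add_apply]
    rw [integral_add (integrable_const _) (hind.const_mul _), integral_const, integral_const_mul,
      integral_indicator_one hAm, measureReal_restrict_apply_univ, volume_real_ball_plane x₀ hε.le,
      measureReal_restrict_apply hAm, smul_eq_mul, mul_comm (π * ε ^ 2)]
    have harea := volume_ball_inter_annulus_le x₀ hε hh.le (a := 1 - t⁻¹)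
      (sub_nonneg.2 (inv_le_one_of_one_le₀ ht1))
    rw [sub_add_cancel, inter_comm] at harea
    gcongr

/-- The mass in any disk is at most `π ‖ρ₀‖`, which is the threshold when `ε² = κ⁻¹`. Nonemptiness
matters for the lower bound, since the infimum of the empty set would be `0`. -/
theorem IsInitialDatum.exists_admissible_radius (h : IsInitialDatum ρ₀)
    (hc : ContinuousOn ρ₀ (Metric.closedBall 0 1)) {κ : ℝ} (hκ : 0 < κ) (t : ℝ) :
    {ε : ℝ | 0 < ε ∧ ∀ x : Plane, |∫ y in Metric.ball x ε, ρ₀ (flow (-t) y)| ≤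
      κ * linftyNorm ρ₀ * (π * ε ^ 2)}.Nonempty := by
  refine ⟨√(κ⁻¹), by positivity, fun x => ?_⟩
  have h1 : ∫ y in Metric.ball x √(κ⁻¹), ρ₀ (flow (-t) y) =
      ∫ y in Metric.ball x √(κ⁻¹) ∩ Metric.closedBall 0 1, ρ₀ (flow (-t) y) := by
    refine setIntegral_eq_of_subset_of_forall_sdiff_eq_zero measurableSet_ball inter_subset_left
      fun y hy => h.zero_outside _ fun hy' => hy.2 ⟨hy.1, ?_⟩
    simpa [norm_flow] using hy'
  have hlt : volume (Metric.ball x √(κ⁻¹) ∩ Metric.closedBall 0 1) < ⊤ :=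
    (measure_mono inter_subset_left).trans_lt measure_ball_lt_top
  rw [h1]
  refine (norm_setIntegral_le_of_norm_le_const (f := fun y => ρ₀ (flow (-t) y)) hlt
    (fun y _ => h.abs_le_linftyNorm hc (flow (-t) y))).trans ?_
  have h2 : volume.real (Metric.ball x √(κ⁻¹) ∩ Metric.closedBall 0 1) ≤ π := by
    refine (measureReal_mono inter_subset_right measure_closedBall_lt_top.ne).trans ?_
    rw [Measure.real, EuclideanSpace.volume_closedBall_fin_two]
    simp [pi_nonneg]
  rw [Real.sq_sqrt (by positivity)]
  calc linftyNorm ρ₀ * volume.real (Metric.ball x √(κ⁻¹) ∩ Metric.closedBall 0 1)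
      ≤ linftyNorm ρ₀ * π := mul_le_mul_of_nonneg_left h2 (linftyNorm_nonneg _)
    _ = _ := by field_simp

/-- Nonzero continuous data are not mixed faster than at the rate `1 / t`. -/
theorem IsInitialDatum.exists_le_geometricMixingScale (h : IsInitialDatum ρ₀)
    (hc : ContinuousOn ρ₀ (Metric.closedBall 0 1)) (hne : ρ₀ ≠ 0) {κ : ℝ} (hκ : 0 < κ)
    (hκ1 : κ < 1) :
    ∃ c : ℝ, 0 < c ∧ ∀ ρ : ℝ → Plane → ℝ, IsSolution velocity ρ₀ ρ →
      ∀ t : ℝ, 1 ≤ t → c * t⁻¹ ≤ geometricMixingScale κ (ρ t) := by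
  set B := linftyNorm ρ₀ with hBdef
  have hB : 0 < B := by
    refine (linftyNorm_nonneg ρ₀).lt_of_ne fun h0 => hne (funext fun x => ?_)
    have := h.abs_le_linftyNorm hc x
    rw [← h0] at this
    exact abs_nonpos_iff.1 this
  -- Otherwise the essential supremum would be at most `κ B < B`.
  obtain ⟨p, hp, hpB⟩ : ∃ p ∈ unitDisk, κ * B < |ρ₀ p| := by
    by_contra hcon
    push Not at hcon
    have hfin := isFiniteMeasure_unitDisk
    have h1 : B ≤ κ * B := by
      have h2 : eLpNormEssSup ρ₀ (volume.restrict unitDisk) ≤ ENNReal.ofReal (κ * B) :=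
        eLpNormEssSup_le_of_ae_bound
          ((ae_restrict_iff' measurableSet_unitDisk).2 (Filter.Eventually.of_forall hcon))
      rw [hBdef, linftyNorm, eLpNorm_exponent_top]
      refine (ENNReal.toReal_mono ENNReal.ofReal_ne_top h2).trans ?_
      rw [ENNReal.toReal_ofReal (by positivity), hBdef, linftyNorm, eLpNorm_exponent_top]
    nlinarith
  -- A level strictly between the threshold and `|ρ₀ p|`, so that by continuity it is exceeded, with
  -- the sign `σ` of `ρ₀ p`, on a whole disk around `p`.
  set m : ℝ := (|ρ₀ p| + κ * B) / 2 with hm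
  obtain ⟨σ, hσ1, hσp⟩ : ∃ σ : ℝ, |σ| = 1 ∧ σ * ρ₀ p = |ρ₀ p| := by
    rcases le_total 0 (ρ₀ p) with h0 | h0
    · exact ⟨1, by simp, by rw [abs_of_nonneg h0, one_mul]⟩
    · exact ⟨-1, by simp, by rw [abs_of_nonpos h0, neg_one_mul]⟩
  have hcp : ContinuousAt ρ₀ p :=
    hc.continuousAt (Filter.mem_of_superset (Metric.isOpen_ball.mem_nhds hp)
      Metric.ball_subset_closedBall)
  have hev : ∀ᶠ y in nhds p, m < σ * ρ₀ y :=
    (hcp.const_mul σ).eventually (lt_mem_nhds (by simp only [hσp]; linarith))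
  obtain ⟨δ, hδ, hδm⟩ := Metric.eventually_nhds_iff_ball.1 hev
  have hp1 : ‖p‖ ≤ 1 := by simpa [unitDisk] using (Metric.ball_subset_closedBall hp)
  -- For `t ≥ 1` the Lipschitz constant satisfies `1 + 2πt ≤ (1 + 2π) t`; a disk of smaller radius
  -- around `flow t p` is thus carried by `flow (-t)` into the disk of radius `δ` around `p`.
  refine ⟨δ / (1 + 2 * π), by positivity, fun ρ hρ t ht => ?_⟩
  have ht0 : 0 < t := by linarith
  rw [hρ.geometricMixingScale_eq h (Filter.EventuallyEq.refl _ ρ₀) ht0.le]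
  refine le_csInf (h.exists_admissible_radius hc hκ t) ?_
  rintro ε ⟨hε, hεb⟩
  by_contra hlt
  rw [not_le] at hlt
  have hεδ : (1 + 2 * π * t) * ε ≤ δ := by
    have h1 : (1 + 2 * π * t) ≤ (1 + 2 * π) * t := by nlinarith [pi_pos]
    calc (1 + 2 * π * t) * ε ≤ ((1 + 2 * π) * t) * (δ / (1 + 2 * π) * t⁻¹) := by gcongr
      _ = δ := by field_simp
  set q := flow t p with hq
  have hlow : ∀ y ∈ Metric.ball q ε, m ≤ σ * ρ₀ (flow (-t) y) := by
    intro y hy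
    refine (hδm _ ?_).le
    have h1 := norm_flow_sub_flow_le (-t) y q
    have h2 : flow (-t) q = p := by rw [hq, flow_flow, neg_add_cancel, flow_zero]
    have h3 : ‖q‖ ≤ 1 := by rwa [hq, norm_flow]
    rw [h2, abs_neg, abs_of_pos ht0] at h1
    rw [Metric.mem_ball, dist_eq_norm] at hy ⊢
    have h4 : (1 + 2 * π * t * ‖q‖) * ‖y - q‖ ≤ (1 + 2 * π * t * 1) * ‖y - q‖ := by gcongr
    have h5 : (1 + 2 * π * t * 1) * ‖y - q‖ < (1 + 2 * π * t) * ε := by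
      rw [mul_one]; gcongr
    linarith
  have hfin : IsFiniteMeasure (volume.restrict (Metric.ball q ε)) :=
    isFiniteMeasure_restrict.2 measure_ball_lt_top.ne
  have hint : Integrable (fun y => σ * ρ₀ (flow (-t) y)) (volume.restrict (Metric.ball q ε)) := by
    refine Integrable.const_mul ?_ σ
    exact Integrable.of_bound ((h.measurable_of_continuousOn hc).comp
      (measurePreserving_flow (-t)).measurable).aestronglyMeasurable B
      (Filter.Eventually.of_forall fun y => h.abs_le_linftyNorm hc _)
  have h1 : m * (π * ε ^ 2) ≤ σ * ∫ y in Metric.ball q ε, ρ₀ (flow (-t) y) := by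
    rw [← integral_const_mul]
    have := setIntegral_mono_on (integrable_const m) hint measurableSet_ball hlow
    rwa [setIntegral_const, volume_real_ball_plane q hε.le, smul_eq_mul, mul_comm] at this
  have h2 := hεb q
  have h3 : σ * ∫ y in Metric.ball q ε, ρ₀ (flow (-t) y) ≤
      |∫ y in Metric.ball q ε, ρ₀ (flow (-t) y)| := by
    refine (le_abs_self _).trans ?_
    rw [abs_mul, hσ1, one_mul]
  have h4 : κ * B * (π * ε ^ 2) < m * (π * ε ^ 2) :=
    mul_lt_mul_of_pos_right (by linarith) (by positivity)
  linarith

end Continuous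

/-! ### Sobolev data: differences in `L¹` and the rate `t^(-α/2)` -/

open scoped Convolution in
/-- Translation estimate for bounded functions with integrable weak gradient on the disk. -/
theorem lintegral_translate_le_of_weakGradient {f : Plane → ℝ} (hf : Measurable f) {B : ℝ}
    (hB : ∀ x, |f x| ≤ B) {g : Plane → Plane}
    (hg : AEStronglyMeasurable g (volume.restrict unitDisk))
    (hfg : ∀ φ : Plane → ℝ, ContDiff ℝ ∞ φ → HasCompactSupport φ →
      tsupport φ ⊆ unitDisk → ∀ w : Plane,
      ∫ x in unitDisk, f x * fderiv ℝ φ x w = -∫ x in unitDisk, inner ℝ (g x) w * φ x)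
    (v : Plane) :
    ∫⁻ x in {x | x ∈ unitDisk ∧ x + v ∈ unitDisk}, ‖f (x + v) - f x‖ₑ ≤
      ‖v‖ₑ * ∫⁻ x in unitDisk, ‖g x‖ₑ := by
  have hDfin := isFiniteMeasure_unitDisk
  set fD : Plane → ℝ := unitDisk.indicator f with hfD
  have hfDi : Integrable fD := by
    rw [hfD, integrable_indicator_iff measurableSet_unitDisk]
    exact Integrable.of_bound hf.aestronglyMeasurable B (Filter.Eventually.of_forall hB)
  obtain ⟨γ, hγm, hγ⟩ := hg.enorm
  let δ : ℕ → ℝ := fun n => 1 / ((n : ℝ) + 1)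
  have hδ : ∀ n, 0 < δ n := fun n => by positivity
  have hδ0 : Filter.Tendsto δ Filter.atTop (nhds 0) := tendsto_one_div_add_atTop_nhds_zero_nat
  let φ : ℕ → ContDiffBump (0 : Plane) := fun n => ⟨δ n / 2, δ n, by have := hδ n; positivity,
    by have := hδ n; linarith⟩
  let η : ℕ → Plane → ℝ := fun n => (φ n).normed volume
  have hηc : ∀ n, HasCompactSupport (η n) := fun n => (φ n).hasCompactSupport_normed
  have hηs : ∀ n, ContDiff ℝ ∞ (η n) := fun n => (φ n).contDiff_normed
  have hηm : ∀ n, Measurable (η n) := fun n => (hηs n).continuous.measurable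
  let L : ℝ →L[ℝ] ℝ →L[ℝ] ℝ := ContinuousLinearMap.mul ℝ ℝ
  let F : ℕ → Plane → ℝ := fun n => fD ⋆[L, volume] (η n)
  have hFs : ∀ n, ContDiff ℝ 1 (F n) := fun n =>
    (hηc n).contDiff_convolution_right L hfDi.locallyIntegrable
      ((hηs n).of_le (by exact_mod_cast le_top))
  have hFd : ∀ n x, HasFDerivAt (F n) ((fD ⋆[L.precompR Plane, volume] fderiv ℝ (η n)) x) x :=
    fun n x => (hηc n).hasFDerivAt_convolution_right L hfDi.locallyIntegrable
      ((hηs n).of_le (by exact_mod_cast le_top)) x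
  -- The mollification of `|g|`: it has the same integral as `|g|` and dominates the gradient of the
  -- mollified `f` at distance more than `δ n` from the unit circle.
  let Γ : ℕ → Plane → ℝ≥0∞ := fun n x => ∫⁻ y in unitDisk, γ y * ‖η n (x - y)‖ₑ
  have hΓm : ∀ n, Measurable (Γ n) := fun n => by
    refine Measurable.lintegral_prod_right' (f := fun p : Plane × Plane =>
      γ p.2 * ‖η n (p.1 - p.2)‖ₑ) ?_
    exact (hγm.comp measurable_snd).mul ((hηm n).comp (measurable_fst.sub measurable_snd)).enorm
  have hη1 : ∀ n, ∫⁻ x, ‖η n x‖ₑ = 1 := by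
    intro n
    rw [← ofReal_integral_norm_eq_lintegral_enorm
      ((hηs n).continuous.integrable_of_hasCompactSupport (hηc n))]
    have : ∫ x, ‖η n x‖ = ∫ x, η n x :=
      integral_congr_ae (Filter.Eventually.of_forall fun x =>
        Real.norm_of_nonneg ((φ n).nonneg_normed x))
    rw [this, (φ n).integral_normed, ENNReal.ofReal_one]
  have hΓint : ∀ n, ∫⁻ x, Γ n x = ∫⁻ x in unitDisk, ‖g x‖ₑ := by
    intro n
    rw [lintegral_lintegral_swap (f := fun x y => γ y * ‖η n (x - y)‖ₑ)
      ((hγm.comp measurable_snd).mul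
        ((hηm n).comp (measurable_fst.sub measurable_snd)).enorm).aemeasurable]
    rw [lintegral_congr_ae hγ]
    refine lintegral_congr fun y => ?_
    have h1 : Measurable fun x => ‖η n (x - y)‖ₑ :=
      ((hηm n).comp (measurable_id.sub_const y)).enorm
    rw [lintegral_const_mul _ h1]
    rw [lintegral_sub_right_eq_self (fun x => ‖η n x‖ₑ) y, hη1, mul_one]
  have hder : ∀ n x w, ‖x‖ < 1 - δ n →
      ‖(fD ⋆[L.precompR Plane, volume] fderiv ℝ (η n)) x w‖ₑ ≤ ‖w‖ₑ * Γ n x := by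
    intro n x w hx
    have h1 : (fD ⋆[L.precompR Plane, volume] fderiv ℝ (η n)) x w =
        ∫ y in unitDisk, f y * fderiv ℝ (η n) (x - y) w := by
      rw [convolution_precompR_apply L hfDi.locallyIntegrable ((hηc n).fderiv ℝ)
        ((hηs n).continuous_fderiv (by simp)), convolution_def,
        ← integral_indicator measurableSet_unitDisk]
      refine integral_congr_ae (Filter.Eventually.of_forall fun y => ?_)
      by_cases hy : y ∈ unitDisk <;> simp [hfD, L, hy]
    have hφs : ContDiff ℝ ∞ fun y => η n (x - y) := (hηs n).comp (contDiff_const.sub contDiff_id)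
    have hsupp : tsupport (fun y => η n (x - y)) ⊆ Metric.closedBall x (δ n) := by
      refine closure_minimal (fun y hy => ?_) Metric.isClosed_closedBall
      have : x - y ∈ Function.support (η n) := hy
      rw [(φ n).support_normed_eq] at this
      rw [Metric.mem_ball, dist_zero_right] at this
      rw [Metric.mem_closedBall, dist_comm, dist_eq_norm]
      exact this.le
    have hsub : Metric.closedBall x (δ n) ⊆ unitDisk := by
      intro y hy
      rw [Metric.mem_closedBall, dist_eq_norm] at hy
      rw [unitDisk, Metric.mem_ball, dist_zero_right]
      have := norm_le_norm_add_norm_sub' y x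
      linarith
    -- The translated mollifier is supported in the open disk, so it is a legitimate test function
    -- for the weak gradient.
    have h2 := hfg (fun y => η n (x - y)) hφs
      ((isCompact_closedBall x (δ n)).of_isClosed_subset (isClosed_tsupport _) hsupp)
      (hsupp.trans hsub) w
    have h3 : ∀ y, fderiv ℝ (fun y => η n (x - y)) y w = -fderiv ℝ (η n) (x - y) w := by
      intro y
      have hd : HasFDerivAt (fun y : Plane => x - y) (-ContinuousLinearMap.id ℝ Plane) y :=
        (hasFDerivAt_id y).const_sub x
      have := (((hηs n).differentiable (by simp)) (x - y)).hasFDerivAt.comp y hd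
      have h4 : HasFDerivAt (fun y => η n (x - y)) _ y := this
      rw [h4.fderiv]
      simp
    simp only [h3, mul_neg, integral_neg, neg_inj] at h2
    rw [h1, h2]
    refine (enorm_integral_le_lintegral_enorm _).trans ?_
    rw [← lintegral_const_mul' _ _ enorm_ne_top]
    refine lintegral_mono_ae ?_
    filter_upwards [hγ] with y hy
    rw [enorm_mul, ← hy, ← mul_assoc]
    gcongr
    rw [mul_comm, ← enorm_norm (g y), ← enorm_norm w, ← enorm_mul]
    refine enorm_le_iff_norm_le.2 ?_
    rw [norm_mul, norm_norm, norm_norm]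
    exact norm_inner_le_norm _ _
  have hseg : ∀ n x, ‖x‖ < 1 - δ n → ‖x + v‖ < 1 - δ n →
      ‖F n (x + v) - F n x‖ₑ ≤ ∫⁻ s in Ioc (0 : ℝ) 1, ‖v‖ₑ * Γ n (x + s • v) := by
    intro n x hx hxv
    have hcurve : ∀ s : ℝ, HasDerivAt (fun s : ℝ => F n (x + s • v))
        (fderiv ℝ (F n) (x + s • v) v) s := by
      intro s
      have h1 : HasDerivAt (fun s : ℝ => x + s • v) v s := by
        simpa using! ((hasDerivAt_id s).smul_const v).const_add x
      exact (((hFs n).differentiable (by simp)) (x + s • v)).hasFDerivAt.comp_hasDerivAt s h1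
    have hcont : Continuous fun s : ℝ => fderiv ℝ (F n) (x + s • v) v :=
      (((hFs n).continuous_fderiv (by simp)).comp (by fun_prop)).clm_apply continuous_const
    have h2 := intervalIntegral.integral_eq_sub_of_hasDerivAt (a := 0) (b := 1)
      (fun s _ => hcurve s) (hcont.intervalIntegrable _ _)
    simp only [one_smul, zero_smul, add_zero] at h2
    rw [← h2, intervalIntegral.integral_of_le zero_le_one]
    refine (enorm_integral_le_lintegral_enorm _).trans ?_
    refine setLIntegral_mono' measurableSet_Ioc fun s hs => ?_
    rw [(hFd n _).fderiv]
    refine hder n _ v ?_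
    have hconv : x + s • v ∈ Metric.ball (0 : Plane) (1 - δ n) := by
      have := (convex_ball (0 : Plane) (1 - δ n)) (x := x) (by simpa using hx) (y := x + v)
        (by simpa using hxv) (a := 1 - s) (b := s) (by linarith [hs.2]) hs.1.le (by ring)
      convert this using 1
      module
    simpa using hconv
  let U : ℕ → Set Plane := fun n => {x | ‖x‖ < 1 - δ n} ∩ {x | ‖x + v‖ < 1 - δ n}
  have hUm : ∀ n, MeasurableSet (U n) := fun n =>
    (measurableSet_lt (f := fun x : Plane => ‖x‖) (g := fun _ => 1 - δ n) (by fun_prop)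
      (by fun_prop)).inter (measurableSet_lt (f := fun x : Plane => ‖x + v‖)
      (g := fun _ => 1 - δ n) (by fun_prop) (by fun_prop))
  have hn : ∀ n, ∫⁻ x, (U n).indicator (fun x => ‖F n (x + v) - F n x‖ₑ) x ≤
      ‖v‖ₑ * ∫⁻ x in unitDisk, ‖g x‖ₑ := by
    intro n
    calc ∫⁻ x, (U n).indicator (fun x => ‖F n (x + v) - F n x‖ₑ) x
        ≤ ∫⁻ x, ∫⁻ s in Ioc (0 : ℝ) 1, ‖v‖ₑ * Γ n (x + s • v) := by
          refine lintegral_mono fun x => ?_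
          by_cases hx : x ∈ U n
          · rw [indicator_of_mem hx]
            exact hseg n x hx.1 hx.2
          · rw [indicator_of_notMem hx]
            exact zero_le
      _ = ∫⁻ s in Ioc (0 : ℝ) 1, ∫⁻ x, ‖v‖ₑ * Γ n (x + s • v) := by
          refine lintegral_lintegral_swap (Measurable.aemeasurable ?_)
          refine Measurable.const_mul ((hΓm n).comp ?_) _
          exact measurable_fst.add (measurable_snd.smul_const v)
      _ = ∫⁻ s in Ioc (0 : ℝ) 1, ‖v‖ₑ * ∫⁻ x in unitDisk, ‖g x‖ₑ := by
          refine lintegral_congr fun s => ?_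
          rw [lintegral_const_mul' _ _ enorm_ne_top,
            lintegral_add_right_eq_self (fun x => Γ n x) (s • v), hΓint]
      _ = _ := by simp
  have hFconv : ∀ᵐ x, Filter.Tendsto (fun n => F n x) Filter.atTop (nhds (fD x)) := by
    have := ContDiffBump.ae_convolution_tendsto_right_of_locallyIntegrable (μ := volume)
      (φ := φ) (l := Filter.atTop) (K := 2) hδ0
      (Filter.Eventually.of_forall fun n => by simp only [φ]; linarith)
      hfDi.locallyIntegrable
    filter_upwards [this] with x hx
    refine hx.congr fun n => ?_
    simp only [F]
    rw [convolution_eq_swap, convolution_def]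
    refine integral_congr_ae (Filter.Eventually.of_forall fun y => ?_)
    simp [L, η, mul_comm]
  have hFconv' : ∀ᵐ x, Filter.Tendsto (fun n => F n (x + v)) Filter.atTop (nhds (fD (x + v))) :=
    (measurePreserving_add_right volume v).quasiMeasurePreserving.ae hFconv
  have hSm : MeasurableSet {x | x ∈ unitDisk ∧ x + v ∈ unitDisk} :=
    measurableSet_unitDisk.inter (measurable_add_const v measurableSet_unitDisk)
  rw [← lintegral_indicator hSm]
  -- The mollified functions converge almost everywhere and the shrunken domains `U n` exhaust the
  -- set, so Fatou's lemma passes the bound to `f`.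
  calc ∫⁻ x, {x | x ∈ unitDisk ∧ x + v ∈ unitDisk}.indicator (fun x => ‖f (x + v) - f x‖ₑ) x
      ≤ ∫⁻ x, Filter.liminf (fun n => (U n).indicator (fun x => ‖F n (x + v) - F n x‖ₑ) x)
          Filter.atTop := by
        refine lintegral_mono_ae ?_
        filter_upwards [hFconv, hFconv'] with x hx1 hx2
        by_cases hx : x ∈ {x | x ∈ unitDisk ∧ x + v ∈ unitDisk}
        · rw [indicator_of_mem hx]
          refine le_of_eq (Filter.Tendsto.liminf_eq ?_).symm
          have h1 : Filter.Tendsto (fun n => ‖F n (x + v) - F n x‖ₑ) Filter.atTop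
              (nhds ‖f (x + v) - f x‖ₑ) := by
            have := (hx2.sub hx1).enorm
            rwa [hfD, indicator_of_mem hx.1, indicator_of_mem hx.2] at this
          refine h1.congr' ?_
          have hlim : Filter.Tendsto (fun n => 1 - δ n) Filter.atTop (nhds 1) := by
            simpa using hδ0.const_sub 1
          have hx1 : ‖x‖ < 1 := by simpa [unitDisk] using hx.1
          have hx2 : ‖x + v‖ < 1 := by simpa [unitDisk] using hx.2
          filter_upwards [hlim.eventually (lt_mem_nhds hx1), hlim.eventually (lt_mem_nhds hx2)]
            with n hn1 hn2
          rw [indicator_of_mem (show x ∈ U n from ⟨hn1, hn2⟩)]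
        · rw [indicator_of_notMem hx]; exact zero_le
    _ ≤ Filter.liminf (fun n => ∫⁻ x, (U n).indicator (fun x => ‖F n (x + v) - F n x‖ₑ) x)
          Filter.atTop := by
        refine lintegral_liminf_le fun n => Measurable.indicator ?_ (hUm n)
        have := (hFs n).continuous.measurable
        exact ((this.comp (measurable_add_const v)).sub this).enorm
    _ ≤ _ := by
        refine (Filter.liminf_le_liminf (Filter.Eventually.of_forall hn)).trans ?_
        simp

/-- The integral over the disk of the differences of `f` between points at distance less than `r`
from each other, in its dependence on the first point. -/
def localDifference (f : Plane → ℝ) (r : ℝ) (x : Plane) : ℝ≥0∞ :=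
  ∫⁻ z in unitDisk, (Metric.ball x r).indicator (fun z => ‖f x - f z‖ₑ) z

theorem measurable_localDifference {f : Plane → ℝ} (hf : Measurable f) (r : ℝ) :
    Measurable (localDifference f r) := by
  have hS : MeasurableSet {p : Plane × Plane | dist p.2 p.1 < r} :=
    measurableSet_lt (by fun_prop) measurable_const
  have hm : Measurable ({p : Plane × Plane | dist p.2 p.1 < r}.indicator
      fun p => ‖f p.1 - f p.2‖ₑ) :=
    (((hf.comp measurable_fst).sub (hf.comp measurable_snd)).enorm).indicator hS
  exact Measurable.lintegral_prod_right' hm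

/-- A bound on differences between nearby points controls radial shifts. -/
theorem lintegral_radialShift_sub_le {f : Plane → ℝ} (hf : Measurable f) {K α h d : ℝ}
    (hα1 : α ≤ 1) (hK : 0 ≤ K) (hh : 0 < h) (hd : 0 ≤ d) (hdh : d ≤ h)
    (hosc : ∀ r, 0 < r → ∫⁻ x in unitDisk, localDifference f r x ≤ ENNReal.ofReal (K * r ^ (2 + α))) :
    ∫⁻ x in Metric.ball (0 : Plane) (1 - h), ‖f (radialShift d x) - f x‖ₑ ≤
      ENNReal.ofReal (9 * K * h ^ α) := by
  set Φ : Plane → ℝ≥0∞ := unitDisk.indicator (localDifference f (2 * h)) with hΦ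
  have hΦm : Measurable Φ := (measurable_localDifference hf _).indicator measurableSet_unitDisk
  -- The triangle inequality through an intermediate point `z`, integrated over `z` within `h` of
  -- `x`; such `z` is within `2h` of the shifted point.
  have hpt : ∀ x ∈ Metric.ball (0 : Plane) (1 - h),
      ENNReal.ofReal (π * h ^ 2) * ‖f (radialShift d x) - f x‖ₑ ≤
        Φ (radialShift d x) + localDifference f h x := by
    intro x hx
    rw [Metric.mem_ball, dist_zero_right] at hx
    have hT := norm_radialShift_sub d x
    rw [abs_of_nonneg hd] at hT
    have hTD : radialShift d x ∈ unitDisk := by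
      rw [unitDisk, Metric.mem_ball, dist_zero_right]
      have := norm_le_norm_add_norm_sub' (radialShift d x) x
      linarith
    have hsub : Metric.ball x h ⊆ unitDisk := by
      intro y hy
      rw [Metric.mem_ball, dist_eq_norm] at hy
      rw [unitDisk, Metric.mem_ball, dist_zero_right]
      have := norm_le_norm_add_norm_sub' y x
      linarith
    have hvol : ENNReal.ofReal (π * h ^ 2) = volume (Metric.ball x h) := by
      rw [EuclideanSpace.volume_ball_fin_two, ENNReal.ofReal_mul pi_nonneg,
        ENNReal.ofReal_pow hh.le, mul_comm]
    have hm : Measurable ((Metric.ball x h).indicator fun z => ‖f x - f z‖ₑ) :=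
      ((measurable_const.sub hf).enorm).indicator measurableSet_ball
    rw [hΦ, indicator_of_mem hTD, localDifference, localDifference, hvol, mul_comm,
      ← setLIntegral_const, ← lintegral_add_right _ hm]
    calc ∫⁻ z in Metric.ball x h, ‖f (radialShift d x) - f x‖ₑ
        ≤ ∫⁻ z in Metric.ball x h,
          ((Metric.ball (radialShift d x) (2 * h)).indicator
            (fun z => ‖f (radialShift d x) - f z‖ₑ) z +
            (Metric.ball x h).indicator (fun z => ‖f x - f z‖ₑ) z) := by
          refine setLIntegral_mono' measurableSet_ball fun z hz => ?_
          have hz2 : z ∈ Metric.ball (radialShift d x) (2 * h) := by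
            rw [Metric.mem_ball] at hz ⊢
            have h1 := dist_triangle z x (radialShift d x)
            rw [dist_comm x, dist_eq_norm (radialShift d x)] at h1
            linarith
          rw [indicator_of_mem hz, indicator_of_mem hz2, ← enorm_neg (f x - f z)]
          have : f (radialShift d x) - f x =
            (f (radialShift d x) - f z) + -(f x - f z) := by ring
          rw [this]
          exact enorm_add_le _ _
      _ ≤ _ := lintegral_mono_set hsub
  have hsum : ENNReal.ofReal (π * h ^ 2) *
      ∫⁻ x in Metric.ball (0 : Plane) (1 - h), ‖f (radialShift d x) - f x‖ₑ ≤
      ENNReal.ofReal (9 * K * h ^ (2 + α)) := by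
    rw [← lintegral_const_mul' _ _ ENNReal.ofReal_ne_top]
    calc ∫⁻ x in Metric.ball (0 : Plane) (1 - h),
          ENNReal.ofReal (π * h ^ 2) * ‖f (radialShift d x) - f x‖ₑ
        ≤ ∫⁻ x in Metric.ball (0 : Plane) (1 - h),
            (Φ (radialShift d x) + localDifference f h x) :=
          setLIntegral_mono' measurableSet_ball hpt
      _ = (∫⁻ x in Metric.ball (0 : Plane) (1 - h), Φ (radialShift d x)) +
          ∫⁻ x in Metric.ball (0 : Plane) (1 - h), localDifference f h x :=
          lintegral_add_right _ (measurable_localDifference hf h)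
      _ ≤ (∫⁻ x, Φ x) + ∫⁻ x in unitDisk, localDifference f h x := by
          exact add_le_add
            ((setLIntegral_le_lintegral _ _).trans (lintegral_radialShift_le hd hΦm))
            (lintegral_mono_set (Metric.ball_subset_ball (by linarith)))
      _ ≤ ENNReal.ofReal (K * (2 * h) ^ (2 + α)) + ENNReal.ofReal (K * h ^ (2 + α)) := by
          rw [hΦ, lintegral_indicator measurableSet_unitDisk]
          exact add_le_add (hosc _ (by positivity)) (hosc _ hh)
      _ ≤ _ := by
          rw [← ENNReal.ofReal_add (by positivity) (by positivity)]
          refine ENNReal.ofReal_le_ofReal ?_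
          rw [Real.mul_rpow (by norm_num) hh.le]
          -- The factor `9` is `8 + 1`: scale `2h` around the shifted point and scale `h` around
          -- `x`.
          have h8 : (2 : ℝ) ^ (2 + α) ≤ 8 := by
            calc (2 : ℝ) ^ (2 + α) ≤ 2 ^ (3 : ℝ) :=
                  Real.rpow_le_rpow_of_exponent_le (by norm_num) (by linarith)
              _ = 8 := by norm_num
          have : 0 ≤ K * h ^ (2 + α) := by positivity
          nlinarith
  have hpi : ENNReal.ofReal (h ^ 2) ≤ ENNReal.ofReal (π * h ^ 2) :=
    ENNReal.ofReal_le_ofReal (by nlinarith [pi_gt_three, sq_nonneg h])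
  have hfin := (mul_le_mul_left hpi _).trans hsum
  have hrw : 9 * K * h ^ (2 + α) = h ^ 2 * (9 * K * h ^ α) := by
    rw [Real.rpow_add hh, Real.rpow_two]; ring
  rw [hrw, ENNReal.ofReal_mul (by positivity)] at hfin
  exact (ENNReal.mul_le_mul_iff_right (by positivity) ENNReal.ofReal_ne_top).1 hfin

/-- Mixing estimate for a function whose differences between nearby points are controlled. -/
theorem abs_integral_ball_flow_le_of_localDifference {f : Plane → ℝ} (hf : Measurable f) {B : ℝ}
    (hB : ∀ x, |f x| ≤ B) (h0 : ∀ x, x ∉ Metric.closedBall (0 : Plane) 1 → f x = 0)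
    (hmean : ∀ᵐ x : Plane, ∫ s in (0 : ℝ)..1, f (rotate (2 * π * s) x) = 0)
    {K α t ε : ℝ} (hα1 : α ≤ 1) (hK : 0 ≤ K) (ht : 1 ≤ t) (hε : 0 ≤ ε)
    (hosc : ∀ r, 0 < r → ∫⁻ x in unitDisk, localDifference f r x ≤ ENNReal.ofReal (K * r ^ (2 + α)))
    (x₀ : Plane) :
    |∫ x in Metric.ball x₀ ε, f (flow (-t) x)| ≤
      2 * π * B * (2 * ε * t⁻¹ + t⁻¹ ^ 2) + (9 * K * t⁻¹ ^ α + 16 * π * B * t⁻¹) := by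
  have hB0 : 0 ≤ B := (abs_nonneg _).trans (hB 0)
  have ht0 : 0 < t := by linarith
  have hh : 0 < t⁻¹ := by positivity
  refine abs_integral_ball_flow_le hf hB hmean ht0 hε x₀ fun s hs => ?_
  have hd : 0 ≤ s / t := div_nonneg hs.1 ht0.le
  have hdh : s / t ≤ t⁻¹ := by
    rw [div_eq_mul_inv]; exact mul_le_of_le_one_left (by positivity) hs.2
  set G : Plane → ℝ := fun z => f (radialShift (s / t) z) - f z with hG
  have hGm : Measurable G := (hf.comp (measurable_radialShift _)).sub hf
  have hmp : MeasurePreserving fun x => rotate (2 * π * s) (flow (-t) x) :=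
    (measurePreserving_rotate (2 * π * s)).comp (measurePreserving_flow (-t))
  set A : Set Plane := {x | 1 - t⁻¹ ≤ ‖x‖ ∧ ‖x‖ ≤ 1} with hA
  have hAm : MeasurableSet A := MeasurableSet.inter
    (measurableSet_le (f := fun _ : Plane => 1 - t⁻¹) (g := fun x => ‖x‖) (by fun_prop)
      (by fun_prop))
    (measurableSet_le (f := fun x : Plane => ‖x‖) (g := fun _ => 1) (by fun_prop) (by fun_prop))
  have hvol : volume A ≤ ENNReal.ofReal (8 * π * t⁻¹) := by
    have h1 := volume_ball_inter_annulus_le (0 : Plane) (ε := 2) two_pos hh.le (a := 1 - t⁻¹)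
      (sub_nonneg.2 (inv_le_one_of_one_le₀ ht))
    rw [sub_add_cancel] at h1
    have h2 : Metric.ball (0 : Plane) 2 ∩ A = A := inter_eq_right.2 fun x hx => by
      have : ‖x‖ ≤ 1 := hx.2
      rw [Metric.mem_ball, dist_zero_right]; linarith
    rw [← h2]
    rw [ENNReal.le_ofReal_iff_toReal_le
      ((measure_mono inter_subset_left).trans_lt measure_ball_lt_top).ne (by positivity)]
    exact h1.trans (le_of_eq (by ring))
  have hpt : ∀ z, ‖G z‖ₑ ≤ (Metric.ball (0 : Plane) (1 - t⁻¹)).indicator (fun z => ‖G z‖ₑ) z +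
      A.indicator (fun _ => ENNReal.ofReal (2 * B)) z := by
    intro z
    by_cases hz1 : z ∈ Metric.ball (0 : Plane) (1 - t⁻¹)
    · rw [indicator_of_mem hz1]; exact le_self_add
    rw [indicator_of_notMem hz1, zero_add]
    rw [Metric.mem_ball, dist_zero_right, not_lt] at hz1
    by_cases hz2 : ‖z‖ ≤ 1
    · rw [indicator_of_mem (show z ∈ A from ⟨hz1, hz2⟩), Real.enorm_eq_ofReal_abs]
      refine ENNReal.ofReal_le_ofReal ?_
      have := abs_sub (f (radialShift (s / t) z)) (f z)
      have h1 := hB (radialShift (s / t) z)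
      have h2 := hB z
      simp only [hG]; linarith
    · rw [not_le] at hz2
      have hz0 : z ≠ 0 := by rw [← norm_pos_iff]; linarith
      have hG0 : G z = 0 := by
        simp only [hG]
        rw [h0 z (by simpa using hz2), h0 (radialShift (s / t) z) (by
          rw [Metric.mem_closedBall, dist_zero_right, norm_radialShift hz0 (by positivity)]
          linarith), sub_self]
      simp [hG0]
  -- The disk of radius `ε` is discarded: its image under flow and rotation may spread over the unit
  -- disk, so only the area-preserving property is used.
  have htotal : ∫⁻ z, ‖G z‖ₑ ≤ ENNReal.ofReal (9 * K * t⁻¹ ^ α + 16 * π * B * t⁻¹) := by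
    calc ∫⁻ z, ‖G z‖ₑ ≤ ∫⁻ z, ((Metric.ball (0 : Plane) (1 - t⁻¹)).indicator (fun z => ‖G z‖ₑ) z +
          A.indicator (fun _ => ENNReal.ofReal (2 * B)) z) := lintegral_mono hpt
      _ = (∫⁻ z in Metric.ball (0 : Plane) (1 - t⁻¹), ‖G z‖ₑ) +
          ENNReal.ofReal (2 * B) * volume A := by
          rw [lintegral_add_right _ (measurable_const.indicator hAm),
            lintegral_indicator measurableSet_ball, lintegral_indicator hAm, setLIntegral_const]
      _ ≤ ENNReal.ofReal (9 * K * t⁻¹ ^ α) +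
          ENNReal.ofReal (2 * B) * ENNReal.ofReal (8 * π * t⁻¹) := by
          gcongr
          exact lintegral_radialShift_sub_le hf hα1 hK hh hd hdh hosc
      _ = _ := by
          rw [← ENNReal.ofReal_mul (by positivity), ← ENNReal.ofReal_add (by positivity)
            (by positivity)]
          congr 1; ring
  have h1 : ∫ x in Metric.ball x₀ ε, |G (rotate (2 * π * s) (flow (-t) x))| =
      (∫⁻ x in Metric.ball x₀ ε, ‖G (rotate (2 * π * s) (flow (-t) x))‖ₑ).toReal :=
    integral_norm_eq_lintegral_enorm (hGm.comp hmp.measurable).aestronglyMeasurable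
  refine (le_of_eq h1).trans ?_
  refine ENNReal.toReal_le_of_le_ofReal (by positivity) ?_
  refine (setLIntegral_le_lintegral _ _).trans ?_
  have h2 := hmp.lintegral_comp hGm.enorm
  rw [h2]
  exact htotal

/-- A bounded Borel representative of an initial datum. -/
theorem IsInitialDatum.exists_representative {ρ₀ : Plane → ℝ} (h : IsInitialDatum ρ₀) :
    ∃ f : Plane → ℝ, Measurable f ∧ f =ᵐ[volume] ρ₀ ∧ (∀ x, |f x| ≤ linftyNorm ρ₀) ∧
      ∀ x, x ∉ Metric.closedBall (0 : Plane) 1 → f x = 0 := by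
  set B := linftyNorm ρ₀ with hB
  have hB0 : 0 ≤ B := linftyNorm_nonneg _
  set g := h.bounded.aestronglyMeasurable.mk ρ₀
  have hg : Measurable g := h.bounded.aestronglyMeasurable.stronglyMeasurable_mk.measurable
  refine ⟨(Metric.closedBall (0 : Plane) 1).indicator fun x => max (-B) (min B (g x)), ?_, ?_,
    fun x => ?_, fun x hx => indicator_of_notMem hx _⟩
  · exact (measurable_const.max (measurable_const.min hg)).indicator measurableSet_closedBall
  · have h1 := h.ae_norm_le
    rw [ae_restrict_iff' measurableSet_unitDisk] at h1
    filter_upwards [h1, ae_notMem_sphere, h.bounded.aestronglyMeasurable.ae_eq_mk]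
      with x hx hxs hxg
    by_cases hxc : x ∈ Metric.closedBall (0 : Plane) 1
    · have hxd : x ∈ unitDisk := lt_of_le_of_ne hxc hxs
      have h2 := abs_le.1 (hx hxd)
      have h3 : g x = ρ₀ x := hxg.symm
      rw [indicator_of_mem hxc, h3, min_eq_right h2.2, max_eq_right h2.1]
    · rw [indicator_of_notMem hxc, h.zero_outside x hxc]
  · by_cases hxc : x ∈ Metric.closedBall (0 : Plane) 1
    · rw [indicator_of_mem hxc, abs_le]
      exact ⟨le_max_left _ _, max_le (by linarith) (min_le_left _ _)⟩
    · rw [indicator_of_notMem hxc]; simpa using hB0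

/-- Each rotation preserves null sets, so by Fubini almost every circular orbit meets the
exceptional set only for a null set of angles. -/
theorem ae_integral_rotate_eq_zero_of_ae_eq {f ρ₀ : Plane → ℝ} (hf : f =ᵐ[volume] ρ₀)
    (h : ∀ᵐ x : Plane, ∫ s in (0 : ℝ)..1, ρ₀ (rotate (2 * π * s) x) = 0) :
    ∀ᵐ x : Plane, ∫ s in (0 : ℝ)..1, f (rotate (2 * π * s) x) = 0 := by
  obtain ⟨N, hN, hNm, hN0⟩ := exists_measurable_superset_of_null (ae_iff.1 hf)
  have hrot : Measurable fun p : Plane × ℝ => rotate (2 * π * p.2) p.1 := by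
    have h1 : Continuous fun p : Plane × ℝ => ((2 * π * p.2, p.1) : ℝ × Plane) := by fun_prop
    exact (continuous_rotate.comp h1).measurable
  have h1 : ∀ᵐ x : Plane, ∀ᵐ s : ℝ, rotate (2 * π * s) x ∉ N := by
    rw [Measure.ae_ae_comm (p := fun x s => rotate (2 * π * s) x ∉ N) (hrot hNm.compl)]
    refine Filter.Eventually.of_forall fun s => ?_
    exact (measurePreserving_rotate (2 * π * s)).quasiMeasurePreserving.ae (p := fun x => x ∉ N)
      (by rw [ae_iff]; simpa using hN0)
  filter_upwards [h, h1] with x hx hx1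
  refine Eq.trans ?_ hx
  refine intervalIntegral.integral_congr_ae (hx1.mono fun s hs _ => ?_)
  by_contra hne
  exact hs (hN hne)

/-- The Gagliardo seminorm controls differences between nearby points. -/
theorem lintegral_localDifference_le_of_gagliardo {ρ₀ f : Plane → ℝ} (hf : f =ᵐ[volume] ρ₀) {α : ℝ}
    (hα : 0 < α) (hα1 : α ≠ 1) (hfin : sobolevSeminorm α ρ₀ < ⊤) (r : ℝ) :
    ∫⁻ x in unitDisk, localDifference f r x ≤
      ENNReal.ofReal ((sobolevSeminorm α ρ₀).toReal * r ^ (2 + α)) := by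
  rw [ENNReal.ofReal_mul ENNReal.toReal_nonneg, ENNReal.ofReal_toReal hfin.ne]
  rw [sobolevSeminorm, if_neg hα1, ← lintegral_mul_const' _ _ ENNReal.ofReal_ne_top]
  refine lintegral_mono_ae ((ae_restrict_of_ae hf).mono fun x hx => ?_)
  rw [← lintegral_mul_const' _ _ ENNReal.ofReal_ne_top, localDifference]
  refine lintegral_mono_ae ((ae_restrict_of_ae hf).mono fun z hz => ?_)
  by_cases hzb : z ∈ Metric.ball x r
  · rw [indicator_of_mem hzb, hx, hz, ← ENNReal.ofReal_mul (by positivity),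
      Real.enorm_eq_ofReal_abs]
    -- On pairs with `|x - z| < r` the Gagliardo kernel is at least `r^(-(2+α))`; on the diagonal
    -- the difference is zero.
    refine ENNReal.ofReal_le_ofReal ?_
    rcases eq_or_ne x z with rfl | hne
    · simp
    · have hpos : 0 < ‖x - z‖ := norm_pos_iff.2 (sub_ne_zero.2 hne)
      have hle : ‖x - z‖ ≤ r := by
        rw [Metric.mem_ball, dist_comm, dist_eq_norm] at hzb; exact hzb.le
      rw [div_mul_eq_mul_div, le_div_iff₀ (by positivity)]
      gcongr
  · rw [indicator_of_notMem hzb]; exact zero_le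

/-- An integrable weak gradient controls differences between nearby points. -/
theorem lintegral_localDifference_le_of_weakGradient {ρ₀ f : Plane → ℝ} (hf : f =ᵐ[volume] ρ₀)
    (hfm : Measurable f) {B : ℝ} (hB : ∀ x, |f x| ≤ B) {g : Plane → Plane}
    (hg : IsWeakGradient ρ₀ g) {A : ℝ} (hA : 0 ≤ A)
    (hgA : ∫⁻ x in unitDisk, ‖g x‖ₑ ≤ ENNReal.ofReal A) {r : ℝ} (hr : 0 < r) :
    ∫⁻ x in unitDisk, localDifference f r x ≤ ENNReal.ofReal (π * A * r ^ (2 + 1 : ℝ)) := by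
  have htr := lintegral_translate_le_of_weakGradient hfm hB
    hg.locallyIntegrable_grad.aestronglyMeasurable (fun φ h1 h2 h3 w => by
      rw [← hg.integral_eq φ h1 h2 h3 w]
      exact integral_congr_ae ((ae_restrict_of_ae hf).mono fun x hx => by simp only [hx]))
  set S : Set (Plane × Plane) := {p | p.1 ∈ unitDisk ∧ p.1 + p.2 ∈ unitDisk ∧ ‖p.2‖ < r} with hS
  have hSm : MeasurableSet S :=
    (measurable_fst measurableSet_unitDisk).inter
      (((measurable_fst.add measurable_snd) measurableSet_unitDisk).inter
        (measurableSet_lt (measurable_norm.comp measurable_snd) measurable_const))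
  set Q : Plane × Plane → ℝ≥0∞ := S.indicator fun p => ‖f (p.1 + p.2) - f p.1‖ₑ with hQ
  have hQm : Measurable Q :=
    ((hfm.comp (measurable_fst.add measurable_snd)).sub (hfm.comp measurable_fst)).enorm.indicator
      hSm
  -- Substitute `z = x + v`; for fixed `v` the translation estimate gives at most `r A`, and the
  -- vectors `v` fill a disk of area `πr²`.
  have h1 : ∫⁻ x in unitDisk, localDifference f r x = ∫⁻ x, ∫⁻ v, Q (x, v) := by
    rw [← lintegral_indicator measurableSet_unitDisk]
    refine lintegral_congr fun x => ?_
    by_cases hx : x ∈ unitDisk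
    · rw [indicator_of_mem hx, localDifference, ← lintegral_indicator measurableSet_unitDisk,
        ← lintegral_add_left_eq_self _ x]
      refine lintegral_congr fun v => ?_
      have hb : x + v ∈ Metric.ball x r ↔ ‖v‖ < r := by
        rw [Metric.mem_ball, dist_eq_norm, add_sub_cancel_left]
      by_cases hxv : x + v ∈ unitDisk
      · by_cases hv : ‖v‖ < r
        · rw [indicator_of_mem hxv, indicator_of_mem (hb.2 hv), hQ,
            indicator_of_mem (show (x, v) ∈ S from ⟨hx, hxv, hv⟩), ← enorm_neg, neg_sub]
        · rw [indicator_of_mem hxv, indicator_of_notMem fun h => hv (hb.1 h), hQ,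
            indicator_of_notMem fun h : (x, v) ∈ S => hv h.2.2]
      · rw [indicator_of_notMem hxv, hQ, indicator_of_notMem fun h : (x, v) ∈ S => hxv h.2.1]
    · rw [indicator_of_notMem hx]
      have : ∀ v, Q (x, v) = 0 := fun v =>
        indicator_of_notMem (fun h : (x, v) ∈ S => hx h.1) _
      simp [this]
  rw [h1, lintegral_lintegral_swap (f := fun x v => Q (x, v)) hQm.aemeasurable]
  calc ∫⁻ v, ∫⁻ x, Q (x, v)
      ≤ ∫⁻ v, (Metric.ball (0 : Plane) r).indicator
          (fun _ => ENNReal.ofReal r * ENNReal.ofReal A) v := by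
        refine lintegral_mono fun v => ?_
        by_cases hv : ‖v‖ < r
        · have hvb : v ∈ Metric.ball (0 : Plane) r := by simpa using hv
          rw [indicator_of_mem hvb]
          have h2 : ∫⁻ x, Q (x, v) =
              ∫⁻ x in {x | x ∈ unitDisk ∧ x + v ∈ unitDisk}, ‖f (x + v) - f x‖ₑ := by
            have hm : MeasurableSet {x | x ∈ unitDisk ∧ x + v ∈ unitDisk} :=
              measurableSet_unitDisk.inter (measurable_add_const v measurableSet_unitDisk)
            rw [← lintegral_indicator hm]
            refine lintegral_congr fun x => ?_
            by_cases hx : x ∈ {x | x ∈ unitDisk ∧ x + v ∈ unitDisk}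
            · rw [indicator_of_mem hx, hQ,
                indicator_of_mem (show (x, v) ∈ S from ⟨hx.1, hx.2, hv⟩)]
            · rw [indicator_of_notMem hx, hQ,
                indicator_of_notMem fun h : (x, v) ∈ S => hx ⟨h.1, h.2.1⟩]
          rw [h2]
          refine (htr v).trans (mul_le_mul' ?_ hgA)
          rw [← ofReal_norm]
          exact ENNReal.ofReal_le_ofReal hv.le
        · have : ∀ x, Q (x, v) = 0 := fun x =>
            indicator_of_notMem (fun h : (x, v) ∈ S => hv h.2.2) _
          simp [this]
    _ = ENNReal.ofReal (π * A * r ^ (2 + 1 : ℝ)) := by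
        rw [lintegral_indicator measurableSet_ball, setLIntegral_const,
          EuclideanSpace.volume_ball_fin_two, ← ENNReal.ofReal_pow hr.le,
          ← ENNReal.ofReal_mul hr.le, ← ENNReal.ofReal_mul (by positivity),
          ← ENNReal.ofReal_mul (by positivity)]
        congr 1
        have : r ^ (2 + 1 : ℝ) = r ^ 3 := by
          rw [show (2 + 1 : ℝ) = ((3 : ℕ) : ℝ) by norm_num, Real.rpow_natCast]
        rw [this]; ring

/-- Functions of finite Sobolev seminorm have controlled differences between nearby points. -/
theorem lintegral_localDifference_le {ρ₀ f : Plane → ℝ} (hf : f =ᵐ[volume] ρ₀)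
    (hfm : Measurable f) {B : ℝ} (hB : ∀ x, |f x| ≤ B) {α : ℝ} (hα : 0 < α)
    (hfin : sobolevSeminorm α ρ₀ < ⊤) {r : ℝ} (hr : 0 < r) :
    ∫⁻ x in unitDisk, localDifference f r x ≤
      ENNReal.ofReal (π * ((sobolevSeminorm α ρ₀).toReal + 1) * r ^ (2 + α)) := by
  set A := (sobolevSeminorm α ρ₀).toReal with hA
  have hA0 : 0 ≤ A := ENNReal.toReal_nonneg
  by_cases hα1 : α = 1
  -- The added `1` makes the inequality strict, so a gradient is extracted from the infimum without
  -- appeal to uniqueness of weak gradients.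
  · have hlt : sobolevSeminorm α ρ₀ < ENNReal.ofReal (A + 1) := by
      rw [← ENNReal.ofReal_toReal hfin.ne, ← hA]
      exact (ENNReal.ofReal_lt_ofReal_iff (by positivity)).2 (by linarith)
    rw [sobolevSeminorm, if_pos hα1] at hlt
    simp only [iInf_lt_iff] at hlt
    obtain ⟨g, hg, hgA⟩ := hlt
    rw [hα1]
    exact lintegral_localDifference_le_of_weakGradient hf hfm hB hg (by positivity) hgA.le hr
  · refine (lintegral_localDifference_le_of_gagliardo hf hα hα1 hfin r).trans ?_
    refine ENNReal.ofReal_le_ofReal ?_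
    gcongr
    nlinarith [pi_gt_three]

/-- Mixing at the rate `t ^ (-α / 2)` for data in `Ẇ^{α,1}`. -/
theorem exists_geometricMixingScale_le_of_sobolev (α κ A B : ℝ) (hα : 0 < α) (hα1 : α ≤ 1)
    (hκ : 0 < κ) : ∃ C₁ : ℝ, 0 < C₁ ∧
      ∀ (ρ₀ : Plane → ℝ) (ρ : ℝ → Plane → ℝ), IsInitialDatum ρ₀ → IsSolution velocity ρ₀ ρ →
        sobolevSeminorm α ρ₀ < ⊤ → (sobolevSeminorm α ρ₀).toReal = A → linftyNorm ρ₀ = B →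
        ∀ t : ℝ, 1 ≤ t → geometricMixingScale κ (ρ t) ≤ C₁ * t ^ (-(α / 2)) := by
  set K := π * (|A| + 1) with hK
  have hK0 : 0 < K := by positivity
  -- The fraction makes `κ B π C₁` dominate all errors, with `22 = 4 + 2 + 16`, and the `1` gives
  -- `C₁ ≥ 1`. The case `B = 0` is settled separately below.
  set C₁ := 1 + (22 * π * |B| + 9 * K) / (κ * |B| * π) with hC₁
  have hC₁1 : 1 ≤ C₁ := le_add_of_nonneg_right (by positivity)
  refine ⟨C₁, by linarith, fun ρ₀ ρ h hρ hfin hA hB t ht => ?_⟩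
  have ht0 : 0 < t := by linarith
  set u := t ^ (-(α / 2)) with hu
  have hu0 : 0 < u := Real.rpow_pos_of_pos ht0 _
  rcases (linftyNorm_nonneg ρ₀).eq_or_lt with hz | hpos
  · exact hρ.geometricMixingScale_le_of_linftyNorm_eq_zero h hz.symm ht0.le (by positivity)
  rw [hB] at hpos
  have hA0 : 0 ≤ A := hA ▸ ENNReal.toReal_nonneg
  rw [abs_of_pos hpos] at hC₁
  rw [abs_of_nonneg hA0] at hK
  obtain ⟨f, hfm, hfe, hfB, hf0⟩ := h.exists_representative
  rw [hB] at hfB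
  refine hρ.geometricMixingScale_le h hfe ht0.le (by positivity) fun x₀ => ?_
  have hosc : ∀ r, 0 < r → ∫⁻ x in unitDisk, localDifference f r x ≤
      ENNReal.ofReal (K * r ^ (2 + α)) := fun r hr => by
    have := lintegral_localDifference_le hfe hfm hfB hα hfin hr
    rwa [hA, ← hK] at this
  have hmain := abs_integral_ball_flow_le_of_localDifference hfm hfB hf0
    (ae_integral_rotate_eq_zero_of_ae_eq hfe (ae_integral_rotate_eq_zero h.circle_average))
    hα1 hK0.le ht (ε := C₁ * u) (by positivity) hosc x₀
  refine hmain.trans ?_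
  rw [hB]
  have hu1 : u ≤ 1 := Real.rpow_le_one_of_one_le_of_nonpos ht (by linarith)
  have hhα : t⁻¹ ^ α = u ^ 2 := by
    rw [hu, Real.inv_rpow ht0.le, ← Real.rpow_neg ht0.le, ← Real.rpow_natCast,
      ← Real.rpow_mul ht0.le]
    congr 1; push_cast; ring
  -- As `α ≤ 1`, the errors of order `1 / t` are dominated by `t^(-α) = u²`, so every term is
  -- compared with `C₁ u²`.
  have hh : t⁻¹ ≤ u ^ 2 := by
    rw [← hhα]
    have h1 : t⁻¹ ≤ 1 := inv_le_one_of_one_le₀ ht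
    calc t⁻¹ = t⁻¹ ^ (1 : ℝ) := (Real.rpow_one _).symm
      _ ≤ t⁻¹ ^ α := Real.rpow_le_rpow_of_exponent_ge (by positivity) h1 hα1
  have hh0 : 0 < t⁻¹ := by positivity
  have hh1 : t⁻¹ ≤ 1 := inv_le_one_of_one_le₀ ht
  rw [hhα]
  have h1 : C₁ * u * t⁻¹ ≤ C₁ * u ^ 2 := by
    calc C₁ * u * t⁻¹ ≤ C₁ * 1 * u ^ 2 := by gcongr
      _ = _ := by ring
  have h2 : t⁻¹ ^ 2 ≤ C₁ * u ^ 2 := by nlinarith [sq_nonneg u]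
  have h3 : t⁻¹ ≤ C₁ * u ^ 2 := by nlinarith [sq_nonneg u]
  have h4 : u ^ 2 ≤ C₁ * u ^ 2 := by nlinarith [sq_nonneg u]
  have h5 : 22 * π * B + 9 * K ≤ κ * B * π * C₁ := by
    have : κ * B * π * C₁ = κ * B * π + (22 * π * B + 9 * K) := by
      rw [hC₁]; field_simp
    rw [this]
    have : 0 < κ * B * π := by positivity
    linarith
  calc 2 * π * B * (2 * (C₁ * u) * t⁻¹ + t⁻¹ ^ 2) + (9 * K * u ^ 2 + 16 * π * B * t⁻¹)
      = 4 * π * B * (C₁ * u * t⁻¹) + 2 * π * B * t⁻¹ ^ 2 + 9 * K * u ^ 2 + 16 * π * B * t⁻¹ := by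
        ring
    _ ≤ 4 * π * B * (C₁ * u ^ 2) + 2 * π * B * (C₁ * u ^ 2) + 9 * K * (C₁ * u ^ 2) +
        16 * π * B * (C₁ * u ^ 2) := by gcongr
    _ = (22 * π * B + 9 * K) * (C₁ * u ^ 2) := by ring
    _ ≤ (κ * B * π * C₁) * (C₁ * u ^ 2) := by gcongr
    _ = κ * B * (π * (C₁ * u) ^ 2) := by ring

end

theorem theorem1p6 :
    -- (i) upper bound for continuous data, with an absolute constant `C`
    (∃ C : ℝ, 0 < C ∧ ∀ (κ : ℝ) (ρ₀ : Plane → ℝ), 0 < κ → κ < 1 → IsInitialDatum ρ₀ →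
      ContinuousOn ρ₀ (Metric.closedBall 0 1) →
      ∃ C' : ℝ, 0 < C' ∧ ∀ ρ : ℝ → Plane → ℝ, IsSolution velocity ρ₀ ρ →
        ∀ t : ℝ, C' ≤ t → geometricMixingScale κ (ρ t) ≤ C / κ ^ 2 * t⁻¹) ∧
    -- (i) optimality: no nonzero continuous datum is mixed at a rate faster than `1 / t`
    (∀ (κ : ℝ) (ρ₀ : Plane → ℝ), 0 < κ → κ < 1 → IsInitialDatum ρ₀ →
      ContinuousOn ρ₀ (Metric.closedBall 0 1) → ρ₀ ≠ 0 →
      ∃ c : ℝ, 0 < c ∧ ∀ ρ : ℝ → Plane → ℝ, IsSolution velocity ρ₀ ρ →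
        ∀ t : ℝ, 1 ≤ t → c * t⁻¹ ≤ geometricMixingScale κ (ρ t)) ∧
    -- (ii) Sobolev data; the constants depend only on `α`, `κ` and the two norms `A`, `B`
    (∀ (α κ A B : ℝ), 0 < α → α ≤ 1 → 0 < κ → κ < 1 →
      ∃ C₁ C₂ : ℝ, 0 < C₁ ∧ 0 < C₂ ∧
        ∀ (ρ₀ : Plane → ℝ) (ρ : ℝ → Plane → ℝ), IsInitialDatum ρ₀ → IsSolution velocity ρ₀ ρ →
          sobolevSeminorm α ρ₀ < ⊤ → (sobolevSeminorm α ρ₀).toReal = A → linftyNorm ρ₀ = B →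
          ∀ t : ℝ, C₂ ≤ t → geometricMixingScale κ (ρ t) ≤ C₁ * t ^ (-(α / 2))) := by
  refine ⟨⟨28, by norm_num, fun κ ρ₀ hκ hκ1 h hc =>
    h.exists_geometricMixingScale_le hc hκ hκ1⟩, fun κ ρ₀ hκ hκ1 h hc hne =>
    h.exists_le_geometricMixingScale hc hne hκ hκ1, fun α κ A B hα hα1 hκ _ => ?_⟩
  obtain ⟨C₁, hC₁, hmix⟩ := exists_geometricMixingScale_le_of_sobolev α κ A B hα hα1 hκ
  exact ⟨C₁, 1, hC₁, one_pos, hmix⟩
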